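/- Let $k$ be a field of characteristic zero and let $q\in k^\times$, of order $m=o(q)\in\{1,2,\dots\}\cup\{\infty\}$. **Smash coproducts.** If a finite group $H$ acts by automorphisms on a group $\Gamma$, then $k[\Gamma]\rtimes k^H$ denotes the Hopf algebra which is $k[\Gamma]\otimes k^H$ as an algebra (with basis $r\#\delta_h$, $r\in\Gamma$, $h\in H$), and $$\Delta(r\#\delta_h)=\sum_{l\in H} r\#\delta_{l^{-1}}\otimes l.r\#\delta_{lh},\qquad \varepsilon(r\#\delta_h)=\delta_{h,1},\qquad S(r\#\delta_h)=h^{-1}.r^{-1}\#\delta_{h^{-1}}.$$ Suppose moreover that $N\lhd\Gamma$ is a normal $H$-stable subgroup and that $\Phi:N\to (k^H)^\times$ is a group morphism with $\Phi(r)(lh)=\Phi(l^{-1}.r)(h)\,\Phi(r)(l)$ and $\Phi(srs^{-1})=\Phi(r)$ for $r\in N$, $s\in\Gamma$, $h,l\in H$. Let $j:\Gamma/N\to\Gamma$ be a section of the projection with $j(1)=1$. Then $k[\Gamma/N]\rtimes_\Phi k^H$ denotes the Hopf algebra $k[\Gamma/N]\otimes k^H$ with the obvious unit and counit and, for $a,b\in\Gamma/N$,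 $h,h'\in H$, $$(a\#\delta_h)(b\#\delta_{h'})=ab\#\delta_h\delta_{h'}\Phi(j(a)j(b)j(ab)^{-1}),$$ $$\Delta(a\#\delta_h)=\sum_{l\in H}a\#\delta_{l^{-1}}\otimes l.a\#\delta_{lh}\Phi(l.j(a)\,j(l.a)^{-1}),$$ $$S(a\#\delta_h)=h^{-1}.a^{-1}\#\Phi\big(j(h^{-1}.a^{-1})^{-1}\,h^{-1}.j(a)^{-1}\big)\delta_{h^{-1}}.$$ Up to isomorphism it does not depend on $j$. **The objects.** Let $\Gamma_{2,2}=\langle g_0,g_1\mid g_0^2=g_1^2=1,\ [g_{i_1}g_{i_2},g_{j_1}g_{j_2}]=1\rangle$ $(=\mathbb Z_2*\mathbb Z_2)$, with the action of $\mathbb Z_2=\langle h\rangle$ exchanging $g_0$ and $g_1$. For $n\ge1$ let $N_n=\langle (g_0g_1)^n\rangle$, an infinite cyclic, normal, $\mathbb Z_2$-stable subgroup, and let $\Phi_n:N_n\to(k^{\mathbb Z_2})^\times$ be the group morphism sending $(g_0g_1)^n$ to the character $\chi$ of $\mathbb Z_2$ with $\chi(h)=-1$. Put $$A(n)=k[\Gamma_{2,2}/N_n]\rtimes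 k^{\mathbb Z_2},\qquad B(n)=k[\Gamma_{2,2}/N_n]\rtimes_{\Phi_n}k^{\mathbb Z_2}.$$ Let $Q=\begin{pmatrix}1&1\\1&q\end{pmatrix}$ and $\theta_{ic}=\dfrac{Q_{i-1,c}\,Q_{i,c-1}}{Q_{ic}\,Q_{i-1,c-1}}$ for $i,c\in\mathbb Z/2$, so that $\theta=\begin{pmatrix}q^{-1}&q\\q&q^{-1}\end{pmatrix}$. Let $\varepsilon_0,\varepsilon_1$ be the canonical basis of $k^2$, and let $$\rho_q:k[\Gamma_{2,2}]\rtimes k^{\mathbb Z_2}\to \mathrm{End}(k^2)\simeq M_2(k)$$ be the algebra map with $\rho_q(g_i\#1)(\varepsilon_c)=\theta_{ic}\,\varepsilon_{c-1}$ and $\rho_q(1\#f)=f(h)\,\mathrm{id}$ for $f\in k^{\mathbb Z_2}$. **Hopf images.** The Hopf image of an algebra map $\rho:A\to R$ from a Hopf algebra $A$ to an algebra $R$ is the final object among factorizations $\rho=\varphi\circ p$ with $p:A\to L$ a surjective Hopf algebra map and $\varphi:L\to R$ an algebra map; that is, for every other such factorization $\rho=\psi\circ p'$ through $p':A\to L'$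 there is a unique Hopf algebra map $f:L'\to L$ with $f\circ p'=p$ and $\varphi\circ f=\psi$. **Proposition.** The Hopf image $A_q$ of $\rho_q$ exists, and, as Hopf algebras: 1. if $m=\infty$, then $A_q\simeq k[\Gamma_{2,2}]\rtimes k^{\mathbb Z_2}$; 2. if $m$ is odd, then $A_q\simeq A(m)$; 3. if $m\equiv 2 \pmod 4$, then $A_q\simeq A(m/2)$; 4. if $4\mid m$, then $A_q\simeq B(m/4)$. Moreover $\dim_k A_q=4\,o(q^4)$ (both sides being infinite when $m=\infty$). -/

import Mathlib

open scoped TensorProduct commutatorElement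

universe u v

noncomputable section

/-- Structure constants for a Hopf algebra on the vector space `k[Q] ⊗ k^H` with basis
`a # δ_h` (`a ∈ Q`, `h ∈ H`), where the group `H` acts by automorphisms on the group `Q`:

* `(a # δ_h) (b # δ_h') = σ a b h • (a b # δ_h)` if `h = h'`, and `0` otherwise,
* `Δ (a # δ_h) = ∑ l, τ l a (l h) • (a # δ_{l⁻¹}) ⊗ (l.a # δ_{l h})`,
* `S (a # δ_h) = ν a h • (h⁻¹.a⁻¹ # δ_{h⁻¹})`.

The fields are the identities among the structure constants that express the Hopf algebra axioms.
The trivial constants give the smash coproduct, see `smashDatum`; the constants attached to a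
quotient datum are constructed in `QuotientDatum.cocycle`. -/
structure SmashCocycle (k : Type*) [Field k] {Q H : Type*} [Group Q] [Group H]
    (act : H →* MulAut Q) where
  σ : Q → Q → H → k
  τ : H → Q → H → k
  ν : Q → H → k
  σ_one_left : ∀ a h, σ 1 a h = 1
  σ_one_right : ∀ a h, σ a 1 h = 1
  σ_assoc : ∀ a b c h, σ a b h * σ (a * b) c h = σ b c h * σ a (b * c) h
  σ_counit : ∀ a b, σ a b 1 = 1
  τ_one_left : ∀ a h, τ 1 a h = 1
  τ_counit : ∀ l a, τ l a 1 = 1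
  τ_unit : ∀ l h, τ l 1 h = 1
  τ_coassoc : ∀ l m a h, τ l a (l * h) * τ m a (m * l⁻¹)
    = τ m a (m * h) * τ (l * m⁻¹) (act m a) (l * h)
  σ_τ : ∀ l a b h, σ a b h * τ l (a * b) (l * h)
    = τ l a (l * h) * τ l b (l * h) * (σ a b l⁻¹ * σ (act l a) (act l b) (l * h))
  ν_left : ∀ l a, τ l a l * ν a l⁻¹ * σ (act l a⁻¹) (act l a) l = 1
  ν_right : ∀ l a, τ l a l * ν (act l a) l * σ a a⁻¹ l⁻¹ = 1

section Hopf

variable {k Q H : Type*} [Field k] [Group Q] [Group H] {act : H →* MulAut Q}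

/-- The vector space with basis the elements `a # δ_h`, to be equipped with the Hopf algebra
structure whose structure constants are `c`. -/
def TwistedSmash (_c : SmashCocycle k act) := Q × H →₀ k

namespace TwistedSmash

variable (c : SmashCocycle k act)

instance : AddCommGroup (TwistedSmash c) := inferInstanceAs (AddCommGroup (Q × H →₀ k))

instance : Module k (TwistedSmash c) := inferInstanceAs (Module k (Q × H →₀ k))

/-- The basis `(a, h) ↦ a # δ_h`. -/
def basis : Module.Basis (Q × H) k (TwistedSmash c) := ⟨LinearEquiv.refl k (Q × H →₀ k)⟩

/-- The basis element `a # δ_h`. -/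
def elt (a : Q) (h : H) : TwistedSmash c := basis c (a, h)

/-- Linear maps out of `TwistedSmash c` from their values on the elements `a # δ_h`. -/
def lift {V : Type*} [AddCommGroup V] [Module k V] (f : Q → H → V) : TwistedSmash c →ₗ[k] V :=
  (basis c).constr k fun x => f x.1 x.2

@[simp]
theorem lift_elt {V : Type*} [AddCommGroup V] [Module k V] (f : Q → H → V) (a : Q) (h : H) :
    lift c f (elt c a h) = f a h := by
  simp [lift, elt, Module.Basis.constr_basis]

variable {c} in
theorem lin_ext {V : Type*} [AddCommGroup V] [Module k V] {f g : TwistedSmash c →ₗ[k] V}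
    (w : ∀ a h, f (elt c a h) = g (elt c a h)) : f = g :=
  (basis c).ext fun x => w x.1 x.2

variable [Fintype H] [DecidableEq H]


/-- The multiplication `(a # δ_h) (b # δ_h') = [h = h'] σ a b h • (a b # δ_h)`. -/
def mulMap : TwistedSmash c →ₗ[k] TwistedSmash c →ₗ[k] TwistedSmash c :=
  lift c fun a h => lift c fun b h' => if h = h' then c.σ a b h • elt c (a * b) h else 0

instance : Mul (TwistedSmash c) := ⟨fun x y => mulMap c x y⟩

/-- The unit is `1 # 1 = ∑ h, 1 # δ_h`. -/
instance : One (TwistedSmash c) := ⟨∑ h, elt c 1 h⟩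

theorem mul_def (x y : TwistedSmash c) : x * y = mulMap c x y := rfl

theorem one_def : (1 : TwistedSmash c) = ∑ h, elt c 1 h := rfl

theorem elt_mul_elt (a b : Q) (h h' : H) :
    elt c a h * elt c b h' = if h = h' then c.σ a b h • elt c (a * b) h else 0 := by
  simp [mul_def, mulMap]

theorem mulMap_assoc (x y z : TwistedSmash c) :
    mulMap c (mulMap c x y) z = mulMap c x (mulMap c y z) := by
  have key : ∀ (a : Q) (h : H) (b : Q) (h' : H) (d : Q) (h'' : H),
      mulMap c (mulMap c (elt c a h) (elt c b h')) (elt c d h'')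
        = mulMap c (elt c a h) (mulMap c (elt c b h') (elt c d h'')) := by
    intro a h b h' d h''
    by_cases h1 : h = h'
    · subst h1
      by_cases h2 : h = h''
      · subst h2
        simp [mulMap, smul_smul, c.σ_assoc, mul_assoc a b d]
      · simp [mulMap, h2]
    · by_cases h2 : h' = h''
      · subst h2
        simp [mulMap, h1]
      · simp [mulMap, h1, h2]
  have step1 : ∀ a h b h', (mulMap c (mulMap c (elt c a h) (elt c b h')))
      = (mulMap c (elt c a h)) ∘ₗ (mulMap c (elt c b h')) := fun a h b h' =>
    lin_ext fun d h'' => key a h b h' d h''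
  have step2 : ∀ a h (z : TwistedSmash c),
      (mulMap c).flip z ∘ₗ mulMap c (elt c a h) = mulMap c (elt c a h) ∘ₗ (mulMap c).flip z :=
    fun a h z => lin_ext fun b h' => LinearMap.congr_fun (step1 a h b h') z
  have step3 : ∀ y z : TwistedSmash c,
      (mulMap c).flip z ∘ₗ (mulMap c).flip y = (mulMap c).flip (mulMap c y z) :=
    fun y z => lin_ext fun a h => LinearMap.congr_fun (step2 a h z) y
  exact LinearMap.congr_fun (step3 y z) x

theorem one_mulMap (x : TwistedSmash c) : mulMap c 1 x = x := by
  have : mulMap c 1 = LinearMap.id := lin_ext fun a h => by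
    simp [one_def, mulMap, LinearMap.sum_apply, c.σ_one_left]
  simp [this]

theorem mulMap_one (x : TwistedSmash c) : mulMap c x 1 = x := by
  have : (mulMap c).flip 1 = LinearMap.id := lin_ext fun a h => by
    simp [one_def, mulMap, c.σ_one_right]
  exact LinearMap.congr_fun this x

instance : Ring (TwistedSmash c) :=
  { (inferInstance : AddCommGroup (TwistedSmash c)) with
    left_distrib := fun x y z => map_add (mulMap c x) y z
    right_distrib := fun x y z => LinearMap.map_add₂ (mulMap c) x y z
    zero_mul := fun x => LinearMap.map_zero₂ (mulMap c) x
    mul_zero := fun x => map_zero (mulMap c x)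
    mul_assoc := mulMap_assoc c
    one_mul := one_mulMap c
    mul_one := mulMap_one c }

instance : Algebra k (TwistedSmash c) :=
  Algebra.ofModule (fun r x y => LinearMap.map_smul₂ (mulMap c) r x y)
    (fun r x y => map_smul (mulMap c x) r y)

/-- `Δ (a # δ_h) = ∑ l, τ l a (l h) • (a # δ_{l⁻¹}) ⊗ (l.a # δ_{l h})` and `ε (a # δ_h) = [h = 1]`. -/
instance : CoalgebraStruct k (TwistedSmash c) where
  comul := lift c fun a h =>
    ∑ l, c.τ l a (l * h) • (elt c a l⁻¹ ⊗ₜ[k] elt c (act l a) (l * h))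
  counit := lift c fun _ h => if h = 1 then 1 else 0

theorem comul_elt (a : Q) (h : H) : Coalgebra.comul (R := k) (elt c a h)
    = ∑ l, c.τ l a (l * h) • (elt c a l⁻¹ ⊗ₜ[k] elt c (act l a) (l * h)) :=
  lift_elt c _ a h

theorem counit_elt (a : Q) (h : H) :
    Coalgebra.counit (R := k) (elt c a h) = if h = 1 then 1 else 0 :=
  lift_elt c _ a h

instance : Coalgebra k (TwistedSmash c) where
  coassoc := lin_ext fun a h => by
    simp only [LinearMap.comp_apply, comul_elt, map_sum, map_smul, LinearMap.rTensor_tmul,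
      LinearMap.lTensor_tmul, TensorProduct.sum_tmul, TensorProduct.tmul_sum,
      LinearEquiv.coe_coe, TensorProduct.smul_tmul', TensorProduct.assoc_tmul,
      Finset.smul_sum, smul_smul]
    rw [Finset.sum_comm]
    refine Finset.sum_congr rfl fun m _ => ?_
    refine Fintype.sum_equiv (Equiv.mulRight m⁻¹) _ _ fun l => ?_
    have e1 : l * m⁻¹ * (m * h) = l * h := by group
    have e2 : (l * m⁻¹)⁻¹ = m * l⁻¹ := by group
    have e3 : act (l * m⁻¹) (act m a) = act l a := by
      rw [← MulAut.mul_apply, ← map_mul]; simp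
    simp only [Equiv.coe_mulRight, e1, e2, e3, ← TensorProduct.smul_tmul', TensorProduct.tmul_smul,
      smul_smul, c.τ_coassoc l m a h]
    rw [mul_comm]
  rTensor_counit_comp_comul := lin_ext fun a h => by
    simp only [LinearMap.comp_apply, comul_elt, map_sum, map_smul, LinearMap.rTensor_tmul,
      counit_elt]
    rw [Finset.sum_eq_single 1]
    · simp [c.τ_one_left]
    · intro l _ hl
      simp [hl]
    · simp
  lTensor_counit_comp_comul := lin_ext fun a h => by
    simp only [LinearMap.comp_apply, comul_elt, map_sum, map_smul, LinearMap.lTensor_tmul,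
      counit_elt]
    rw [Finset.sum_eq_single h⁻¹]
    · simp [c.τ_counit]
    · intro l _ hl
      have : ¬ l * h = 1 := fun e => hl (eq_inv_of_mul_eq_one_left e)
      simp [this]
    · simp

theorem bilin_ext {V : Type*} [AddCommGroup V] [Module k V]
    {f g : TwistedSmash c →ₗ[k] TwistedSmash c →ₗ[k] V}
    (w : ∀ a h b h', f (elt c a h) (elt c b h') = g (elt c a h) (elt c b h')) : f = g :=
  lin_ext fun a h => lin_ext fun b h' => w a h b h'

instance : Bialgebra k (TwistedSmash c) where
  counit_one := by simp [one_def, counit_elt]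
  mul_compr₂_counit := bilin_ext c fun a h b h' => by
    simp only [LinearMap.compr₂_apply, LinearMap.mul_apply', LinearMap.compl₁₂_apply,
      elt_mul_elt, counit_elt]
    by_cases h1 : h = h'
    · subst h1
      by_cases h2 : h = 1
      · subst h2; simp [counit_elt, c.σ_counit]
      · simp [counit_elt, h2]
    · by_cases h2 : h = 1
      · subst h2; simp [h1, Ne.symm h1]
      · simp [h1, h2]
  comul_one := by
    simp only [one_def, map_sum, comul_elt, map_one, c.τ_unit, one_smul,
      Algebra.TensorProduct.one_def, TensorProduct.sum_tmul, TensorProduct.tmul_sum]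
    rw [Finset.sum_comm]
    conv_rhs => rw [Finset.sum_comm]
    refine Fintype.sum_equiv (Equiv.inv H) _ _ fun l => ?_
    exact Fintype.sum_equiv (Equiv.mulLeft l) _ _ fun h => rfl
  mul_compr₂_comul := bilin_ext c fun a h b h' => by
    simp only [LinearMap.compr₂_apply, LinearMap.mul_apply', LinearMap.compl₁₂_apply,
      elt_mul_elt, comul_elt, Finset.sum_mul_sum, smul_mul_smul_comm,
      Algebra.TensorProduct.tmul_mul_tmul, inv_inj]
    have : ∀ l : H, (∑ l', (c.τ l a (l * h) * c.τ l' b (l' * h')) •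
        ((if l = l' then c.σ a b l⁻¹ • elt c (a * b) l⁻¹ else 0) ⊗ₜ[k]
          (if l * h = l' * h' then
            c.σ (act l a) (act l' b) (l * h) • elt c (act l a * act l' b) (l * h) else 0)))
        = if h = h' then (c.τ l a (l * h) * c.τ l b (l * h)) •
          ((c.σ a b l⁻¹ • elt c (a * b) l⁻¹) ⊗ₜ[k]
            (c.σ (act l a) (act l b) (l * h) • elt c (act l a * act l b) (l * h))) else 0 := by
      intro l
      rw [Finset.sum_eq_single l]
      · by_cases h1 : h = h'
        · subst h1; simp
        · simp [h1]
      · intro l' _ hl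
        simp [Ne.symm hl]
      · simp
    simp only [this]
    by_cases h1 : h = h'
    · subst h1
      simp only [if_true, map_smul, comul_elt, Finset.smul_sum, smul_smul,
        ← TensorProduct.smul_tmul', TensorProduct.tmul_smul, c.σ_τ, map_mul]
      refine Finset.sum_congr rfl fun l _ => ?_
      rw [mul_comm (c.σ a b l⁻¹)]
    · simp [h1]

/-- The antipode `S (a # δ_h) = ν a h • (h⁻¹.a⁻¹ # δ_{h⁻¹})`. -/
instance : HopfAlgebra k (TwistedSmash c) where
  antipode := lift c fun a h => c.ν a h • elt c (act h⁻¹ a⁻¹) h⁻¹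
  mul_antipode_rTensor_comul := lin_ext fun a h => by
    simp only [LinearMap.comp_apply, comul_elt, map_sum, map_smul, LinearMap.rTensor_tmul,
      LinearMap.mul'_apply, lift_elt, counit_elt, smul_mul_assoc, elt_mul_elt,
      Algebra.linearMap_apply, inv_inv]
    by_cases h1 : h = 1
    · subst h1
      simp only [mul_one, if_true, map_one, one_def]
      refine Finset.sum_congr rfl fun l _ => ?_
      rw [← map_mul, inv_mul_cancel, map_one, smul_smul, smul_smul, c.ν_left, one_smul]
    · simp [h1]
  mul_antipode_lTensor_comul := lin_ext fun a h => by
    simp only [LinearMap.comp_apply, comul_elt, map_sum, map_smul, LinearMap.lTensor_tmul,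
      LinearMap.mul'_apply, lift_elt, counit_elt, mul_smul_comm, elt_mul_elt,
      Algebra.linearMap_apply]
    by_cases h1 : h = 1
    · subst h1
      simp only [mul_one, if_true, map_one, one_def]
      refine Fintype.sum_equiv (Equiv.inv H) _ _ fun l => ?_
      have e3 : act l⁻¹ (act l a)⁻¹ = a⁻¹ := by
        rw [← map_inv, ← MulAut.mul_apply, ← map_mul]; simp
      rw [e3, mul_inv_cancel, smul_smul, smul_smul, c.ν_right, one_smul]
      rfl
    · simp [h1]

end TwistedSmash

end Hopf

section Smash

variable (k : Type*) [Field k] {Γ H : Type*} [Group Γ] [Group H] (act : H →* MulAut Γ)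

/-- The trivial structure constants. -/
def smashDatum : SmashCocycle k act where
  σ _ _ _ := 1
  τ _ _ _ := 1
  ν _ _ := 1
  σ_one_left _ _ := rfl
  σ_one_right _ _ := rfl
  σ_assoc _ _ _ _ := rfl
  σ_counit _ _ := rfl
  τ_one_left _ _ := rfl
  τ_counit _ _ := rfl
  τ_unit _ _ := rfl
  τ_coassoc _ _ _ _ := rfl
  σ_τ _ _ _ _ := by simp
  ν_left _ _ := by simp
  ν_right _ _ := by simp

theorem smashDatum_σ (a b : Γ) (h : H) : (smashDatum k act).σ a b h = 1 := rfl

/-- The smash coproduct `k[Γ] ⋊ k^H`: it is `k[Γ] ⊗ k^H` as an algebra, with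
`Δ (r # δ_h) = ∑ l, (r # δ_{l⁻¹}) ⊗ (l.r # δ_{l h})`, `ε (r # δ_h) = [h = 1]` and
`S (r # δ_h) = h⁻¹.r⁻¹ # δ_{h⁻¹}`. -/
abbrev SmashCoproduct := TwistedSmash (smashDatum k act)

variable {k} {act} in
/-- The representation of `k[Γ] ⋊ k^H` attached to a representation `π` of `Γ` and a point `y` of
`H`: it sends `r # f` to `f y • π r`, that is, `r # δ_h` to `[h = y] • π r`. -/
def smashRep [Fintype H] [DecidableEq H] {R : Type*} [Ring R] [Algebra k R] (π : Γ →* R) (y : H) :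
    SmashCoproduct k act →ₐ[k] R :=
  AlgHom.ofLinearMap (TwistedSmash.lift _ fun r h => if h = y then π r else 0)
    (by simp [TwistedSmash.one_def])
    (by
      intro u v
      have key : ∀ a h b h', TwistedSmash.lift (smashDatum k act)
            (fun r h => if h = y then π r else 0)
            (TwistedSmash.elt _ a h * TwistedSmash.elt _ b h')
          = (if h = y then π a else 0) * (if h' = y then π b else 0) := by
        intro a h b h'
        rw [TwistedSmash.elt_mul_elt]
        by_cases h1 : h = h'
        · subst h1
          by_cases h2 : h = y <;> simp [h2, smashDatum_σ]
        · by_cases h2 : h = y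
          · subst h2; simp [h1, Ne.symm h1]
          · simp [h1, h2]
      have : (LinearMap.mul k (SmashCoproduct k act)).compr₂
            (TwistedSmash.lift _ fun r h => if h = y then π r else 0)
          = (LinearMap.mul k R).compl₁₂
            (TwistedSmash.lift _ fun r h => if h = y then π r else 0)
            (TwistedSmash.lift _ fun r h => if h = y then π r else 0) :=
        TwistedSmash.bilin_ext _ fun a h b h' => by
          simpa using key a h b h'
      exact LinearMap.congr_fun (LinearMap.congr_fun this u) v)

/-- A quotient datum `(N, Φ)` for `H` acting on `Γ` (with full subgroup `H`). The group of units
of `k^H` is `H → kˣ`. -/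
structure QuotientDatum where
  N : Subgroup Γ
  normal : N.Normal
  stable : ∀ h, ∀ r ∈ N, act h r ∈ N
  Φ : N →* (H → kˣ)
  Φ_mul : ∀ (r : N) (l h : H), Φ r (l * h) = Φ ⟨act l⁻¹ r, stable _ _ r.2⟩ h * Φ r l
  Φ_conj : ∀ (r : N) (s : Γ), Φ r = Φ ⟨s * r * s⁻¹, normal.conj_mem _ r.2 s⟩

attribute [instance] QuotientDatum.normal

variable {k}

/-- The action on `Γ ⧸ N` induced by the action on `Γ`, for an `H`-stable normal subgroup `N`. -/
def quotientAct (N : Subgroup Γ) [N.Normal] (stable : ∀ h, ∀ r ∈ N, act h r ∈ N) :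
    H →* MulAut (Γ ⧸ N) where
  toFun h :=
    { toFun := QuotientGroup.map N N (act h).toMonoidHom (stable h)
      invFun := QuotientGroup.map N N (act h⁻¹).toMonoidHom (stable h⁻¹)
      left_inv := fun x => by
        induction x using QuotientGroup.induction_on with
        | H r => simp
      right_inv := fun x => by
        induction x using QuotientGroup.induction_on with
        | H r => simp
      map_mul' := map_mul _ }
  map_one' := by
    ext x
    induction x using QuotientGroup.induction_on with
    | H r => simp
  map_mul' g h := by
    ext x
    induction x using QuotientGroup.induction_on with
    | H r => simp

@[simp]
theorem quotientAct_mk (N : Subgroup Γ) [N.Normal] (stable : ∀ h, ∀ r ∈ N, act h r ∈ N)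
    (h : H) (r : Γ) : quotientAct act N stable h (r : Γ ⧸ N) = (act h r : Γ) := rfl

/-- A section `j` of the projection `Γ → Γ ⧸ N` with `j 1 = 1`. -/
structure NormalizedSection (N : Subgroup Γ) [N.Normal] where
  j : Γ ⧸ N → Γ
  mk_j : ∀ a, ((j a : Γ) : Γ ⧸ N) = a
  j_one : j 1 = 1

theorem NormalizedSection.nonempty (N : Subgroup Γ) [N.Normal] : Nonempty (NormalizedSection N) :=
  by
  classical
  refine ⟨⟨fun a => if a = 1 then 1 else a.out, fun a => ?_, by simp⟩⟩
  by_cases h : a = 1 <;> simp [h]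

namespace QuotientDatum

variable {act} (D : QuotientDatum k act) (s : NormalizedSection D.N)

/-- `Φ`, extended by `1` outside `N`; only used in proofs. -/
def ext (r : Γ) : H → kˣ := by
  classical exact if hr : r ∈ D.N then D.Φ ⟨r, hr⟩ else 1

theorem Φ_eq (r : Γ) (hr : r ∈ D.N) : D.Φ ⟨r, hr⟩ = D.ext r := by
  simp [ext, hr]

theorem ext_mul {r t : Γ} (hr : r ∈ D.N) (ht : t ∈ D.N) :
    D.ext (r * t) = D.ext r * D.ext t := by
  rw [← D.Φ_eq r hr, ← D.Φ_eq t ht, ← D.Φ_eq (r * t) (mul_mem hr ht), ← map_mul]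
  rfl

theorem ext_one : D.ext 1 = 1 := by
  rw [← D.Φ_eq 1 (one_mem _)]
  exact map_one D.Φ

theorem ext_conj {r : Γ} (hr : r ∈ D.N) (t : Γ) : D.ext (t * r * t⁻¹) = D.ext r := by
  rw [← D.Φ_eq r hr, ← D.Φ_eq _ (D.normal.conj_mem _ hr t), D.Φ_conj ⟨r, hr⟩ t]

theorem ext_swap {r t : Γ} (h : r * t ∈ D.N) : D.ext (t * r) = D.ext (r * t) := by
  rw [← D.ext_conj h t]
  congr 1
  group

theorem ext_shift {r : Γ} (hr : r ∈ D.N) (l h : H) :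
    D.ext (act l r) (l * h) * D.ext r l⁻¹ = D.ext r h := by
  have e := fun h => D.Φ_mul ⟨act l r, D.stable _ _ hr⟩ l h
  have e1 : act l⁻¹ (act l r) = r := by rw [← MulAut.mul_apply, ← map_mul]; simp
  simp only [e1, D.Φ_eq] at e
  have e2 : ∀ x, D.ext x (1 : H) = 1 := by
    intro x
    by_cases hx : x ∈ D.N
    · have := D.Φ_mul ⟨x, hx⟩ 1 1
      simp only [D.Φ_eq, mul_one, inv_one, map_one, MulAut.one_apply] at this
      simpa using this
    · simp [ext, hx]
  have e3 := e l⁻¹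
  rw [mul_inv_cancel, e2] at e3
  rw [e h, mul_assoc, mul_comm (D.ext (act l r) l), ← e3, mul_one]

theorem ext_at_one (x : Γ) : D.ext x (1 : H) = 1 := by
  by_cases hx : x ∈ D.N
  · have := D.ext_shift hx 1 1
    simpa using this
  · simp [ext, hx]

theorem mem_σ (a b : Γ ⧸ D.N) : s.j a * s.j b * (s.j (a * b))⁻¹ ∈ D.N := by
  rw [← QuotientGroup.eq_one_iff]
  simp [s.mk_j]

theorem mem_τ (l : H) (a : Γ ⧸ D.N) :
    act l (s.j a) * (s.j (quotientAct act D.N D.stable l a))⁻¹ ∈ D.N := by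
  rw [← QuotientGroup.eq_one_iff, QuotientGroup.mk_mul, QuotientGroup.mk_inv, s.mk_j,
    ← quotientAct_mk act D.N D.stable, s.mk_j, mul_inv_cancel]

theorem mem_ν (a : Γ ⧸ D.N) (h : H) :
    (s.j (quotientAct act D.N D.stable h⁻¹ a⁻¹))⁻¹ * act h⁻¹ (s.j a)⁻¹ ∈ D.N := by
  rw [← QuotientGroup.eq_one_iff, QuotientGroup.mk_mul, QuotientGroup.mk_inv, s.mk_j,
    ← quotientAct_mk act D.N D.stable, QuotientGroup.mk_inv, s.mk_j, inv_mul_cancel]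

/-- The structure constants of `k[Γ/N] ⋊_Φ k^H`, computed with the section `j`:
* `(a # δ_h) (b # δ_h') = a b # δ_h δ_h' Φ(j(a) j(b) j(ab)⁻¹)`,
* `Δ (a # δ_h) = ∑ l, (a # δ_{l⁻¹}) ⊗ (l.a # δ_{l h} Φ(l.j(a) j(l.a)⁻¹))`,
* `S (a # δ_h) = h⁻¹.a⁻¹ # Φ(j(h⁻¹.a⁻¹)⁻¹ h⁻¹.j(a)⁻¹) δ_{h⁻¹}`. -/
def cocycle : SmashCocycle k (quotientAct act D.N D.stable) where
  σ a b h := D.Φ ⟨s.j a * s.j b * (s.j (a * b))⁻¹, D.mem_σ s a b⟩ h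
  τ l a h :=
    D.Φ ⟨act l (s.j a) * (s.j (quotientAct act D.N D.stable l a))⁻¹, D.mem_τ s l a⟩ h
  ν a h := D.Φ ⟨(s.j (quotientAct act D.N D.stable h⁻¹ a⁻¹))⁻¹ * act h⁻¹ (s.j a)⁻¹,
    D.mem_ν s a h⟩ h⁻¹
  σ_one_left a h := by simp [D.Φ_eq, s.j_one, D.ext_one]
  σ_one_right a h := by simp [D.Φ_eq, s.j_one, D.ext_one]
  σ_assoc a b c h := by
    simp only [D.Φ_eq, ← Units.val_mul, ← Pi.mul_apply]
    have e : ∀ A B C X Y Z : Γ, A * B * X⁻¹ * (X * C * Z⁻¹)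
        = A * (B * C * Y⁻¹) * A⁻¹ * (A * Y * Z⁻¹) := by intros; group
    rw [← D.ext_mul (D.mem_σ s _ _) (D.mem_σ s _ _), ← D.ext_conj (D.mem_σ s b c) (s.j a),
      ← D.ext_mul (D.normal.conj_mem _ (D.mem_σ s b c) _) (D.mem_σ s _ _), mul_assoc a b c,
      ← e]
  σ_counit a b := by simp [D.Φ_eq, D.ext_at_one]
  τ_one_left a h := by simp [D.Φ_eq, D.ext_one]
  τ_counit l a := by simp [D.Φ_eq, D.ext_at_one]
  τ_unit l h := by simp [D.Φ_eq, s.j_one, D.ext_one]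
  τ_coassoc l m a h := by
    simp only [D.Φ_eq, ← Units.val_mul]
    congr 1
    have e3 : quotientAct act D.N D.stable (l * m⁻¹) (quotientAct act D.N D.stable m a)
        = quotientAct act D.N D.stable l a := by
      rw [← MulAut.mul_apply, ← map_mul]; simp
    have e4 : act (l * m⁻¹) (act m (s.j a)) = act l (s.j a) := by
      rw [← MulAut.mul_apply, ← map_mul]; simp
    have e1 := D.ext_shift (D.mem_τ s m a) (l * m⁻¹) (m * h)
    have e2 : (l * m⁻¹)⁻¹ = m * l⁻¹ := by group
    have e5 : l * m⁻¹ * (m * h) = l * h := by group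
    have e6 := D.mem_τ s (l * m⁻¹) (quotientAct act D.N D.stable m a)
    have e7 := D.ext_mul (D.stable (l * m⁻¹) _ (D.mem_τ s m a)) e6
    rw [e2, e5] at e1
    have e8 : act (l * m⁻¹) (act m (s.j a) * (s.j (quotientAct act D.N D.stable m a))⁻¹) *
        (act (l * m⁻¹) (s.j (quotientAct act D.N D.stable m a)) *
          (s.j (quotientAct act D.N D.stable l a))⁻¹)
        = act l (s.j a) * (s.j (quotientAct act D.N D.stable l a))⁻¹ := by
      rw [← mul_assoc, ← map_mul (act (l * m⁻¹)), inv_mul_cancel_right, e4]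
    rw [← e1, mul_right_comm, ← Pi.mul_apply, ← e7, e3, e8]
  σ_τ l a b h := by
    simp only [D.Φ_eq, ← Units.val_mul]
    congr 1
    have e1 := D.ext_shift (D.mem_σ s a b) l h
    have e2 := D.mem_σ s (quotientAct act D.N D.stable l a) (quotientAct act D.N D.stable l b)
    rw [← map_mul] at e2
    have e3 := D.normal.conj_mem _ (D.mem_τ s l b) (s.j (quotientAct act D.N D.stable l a))
    have m1 := congrFun (D.ext_mul (D.stable l _ (D.mem_σ s a b)) (D.mem_τ s l (a * b))) (l * h)
    have m2 := congrFun (D.ext_mul (D.mem_τ s l a) e3) (l * h)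
    have m3 := congrFun (D.ext_mul (mul_mem (D.mem_τ s l a) e3) e2) (l * h)
    have m4 := congrFun (D.ext_conj (D.mem_τ s l b) (s.j (quotientAct act D.N D.stable l a)))
      (l * h)
    have e : ∀ A B P X Y Z : Γ, A * B * P⁻¹ * (P * Z⁻¹)
        = A * X⁻¹ * (X * (B * Y⁻¹) * X⁻¹) * (X * Y * Z⁻¹) := by intros; group
    rw [map_mul (act l), map_mul (act l), map_inv (act l),
      e _ _ _ (s.j (quotientAct act D.N D.stable l a)) (s.j (quotientAct act D.N D.stable l b)),
      m3, Pi.mul_apply, m2, Pi.mul_apply, m4, Pi.mul_apply, ← map_inv (act l), ← map_mul (act l),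
      ← map_mul (act l)] at m1
    rw [← e1, mul_right_comm, ← m1, ← map_mul (quotientAct act _ _ l)]
    rw [mul_comm (D.ext _ l⁻¹), ← mul_assoc]
  ν_left l a := by
    simp only [D.Φ_eq, ← Units.val_mul, inv_inv]
    have e0 := D.mem_ν s a l⁻¹
    have e2 := D.mem_σ s (quotientAct act D.N D.stable l a⁻¹) (quotientAct act D.N D.stable l a)
    have e1 := D.mem_τ s l a
    rw [← map_mul, inv_mul_cancel, map_one, s.j_one, inv_one, mul_one] at e2
    rw [inv_inv] at e0
    rw [← map_mul (quotientAct act _ _ l), inv_mul_cancel, map_one, s.j_one, inv_one, mul_one,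
      ← D.ext_swap e0, ← D.ext_swap e1, ← Pi.mul_apply, ← Pi.mul_apply,
      ← D.ext_mul ((D.normal.mem_comm_iff).1 e1) ((D.normal.mem_comm_iff).1 e0),
      ← D.ext_mul (mul_mem ((D.normal.mem_comm_iff).1 e1) ((D.normal.mem_comm_iff).1 e0)) e2]
    have : ∀ A B C : Γ, B⁻¹ * A * (A⁻¹ * C⁻¹) * (C * B) = 1 := by intros; group
    rw [map_inv, this, D.ext_one]
    simp
  ν_right l a := by
    simp only [D.Φ_eq, ← Units.val_mul]
    have f1 : quotientAct act D.N D.stable l⁻¹ (quotientAct act D.N D.stable l a) = a := by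
      rw [← MulAut.mul_apply, ← map_mul]; simp
    have e0 := D.mem_ν s (quotientAct act D.N D.stable l a) l
    have e2 := D.mem_σ s a a⁻¹
    have e1 := D.mem_τ s l⁻¹ (quotientAct act D.N D.stable l a)
    rw [f1] at e1
    rw [map_inv (quotientAct act _ _ l⁻¹), f1] at e0 ⊢
    rw [mul_inv_cancel, s.j_one, inv_one, mul_one] at e2
    have f2 : act l (act l⁻¹ (s.j (quotientAct act D.N D.stable l a)))
        = s.j (quotientAct act D.N D.stable l a) := by
      rw [← MulAut.mul_apply, ← map_mul]; simp
    have e5 := inv_mem e1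
    rw [mul_inv_rev, inv_inv] at e5
    have e3 := D.ext_shift e5 l 1
    have e6 : s.j a⁻¹ * s.j a ∈ D.N := (D.normal.mem_comm_iff).1 e2
    have e7 := (D.normal.mem_comm_iff).1 e0
    have e8 : ∀ X Y Z : Γ, X * Y⁻¹ * (Y * Z) = X * Z := by intros; group
    rw [map_mul, map_inv, f2, D.ext_at_one, mul_one] at e3
    rw [mul_inv_cancel, s.j_one, inv_one, mul_one, mul_assoc, ← Pi.mul_apply, ← D.ext_swap e0,
      ← D.ext_swap e2, ← D.ext_mul e7 e6, e8, map_inv (act l⁻¹), D.ext_swap e5, e3, Units.val_one]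
end QuotientDatum

end Smash

section HopfImage

universe w x

/-- A factorization `ρ = φ ∘ p` of an algebra map `ρ : A → R` through a Hopf algebra `L`, with `p`
a surjective Hopf algebra map and `φ` an algebra map. (A bialgebra map between Hopf algebras
commutes with the antipodes.) -/
def IsHopfFactorization {k : Type u} [Field k] {A : Type v} [Ring A] [HopfAlgebra k A]
    {R : Type w} [Ring R] [Algebra k R] (ρ : A →ₐ[k] R)
    {L : Type x} [Ring L] [HopfAlgebra k L] (p : A →ₐc[k] L) (φ : L →ₐ[k] R) : Prop :=
  Function.Surjective p ∧ ∀ a, φ (p a) = ρ a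

/-- `(L, p, φ)` is the Hopf image of `ρ : A → R`: a final object in the category of factorizations
of `ρ`. As the map `q` of a factorization is surjective, every factorization is isomorphic to one
through a Hopf algebra in the universe of `A`. -/
def IsHopfImage {k : Type u} [Field k] {A : Type v} [Ring A] [HopfAlgebra k A]
    {R : Type w} [Ring R] [Algebra k R] (ρ : A →ₐ[k] R)
    {L : Type x} [Ring L] [HopfAlgebra k L] (p : A →ₐc[k] L) (φ : L →ₐ[k] R) : Prop :=
  IsHopfFactorization ρ p φ ∧
    ∀ (L' : Type v) [Ring L'] [HopfAlgebra k L'] (q : A →ₐc[k] L') (ψ : L' →ₐ[k] R),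
      IsHopfFactorization ρ q ψ →
        ∃! f : L' →ₐc[k] L, (∀ a, f (q a) = p a) ∧ ∀ b, φ (f b) = ψ b

end HopfImage

section Gamma

/-- The relators of `Γ_{M,N}`: the `g_i ^ N`, and the commutators of
`g_{i_1} ⋯ g_{i_N}` and `g_{j_1} ⋯ g_{j_N}`. -/
def gammaRels (M N : ℕ) : Set (FreeGroup (ZMod M)) :=
  Set.range (fun i => FreeGroup.of i ^ N) ∪
    Set.range fun x : (Fin N → ZMod M) × (Fin N → ZMod M) =>
      ⁅(List.ofFn fun c => FreeGroup.of (x.1 c)).prod,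
        (List.ofFn fun c => FreeGroup.of (x.2 c)).prod⁆

/-- The group `Γ_{M,N}`. -/
abbrev Gamma (M N : ℕ) := PresentedGroup (gammaRels M N)

/-- The generators `g_i` of `Γ_{M,N}`. -/
def gen {M N : ℕ} (i : ZMod M) : Gamma M N := PresentedGroup.of i

theorem gen_pow {M N : ℕ} (i : ZMod M) : (gen i : Gamma M N) ^ N = 1 :=
  PresentedGroup.one_of_mem (Or.inl ⟨i, rfl⟩)

theorem gen_comm {M N : ℕ} (x y : Fin N → ZMod M) :
    ⁅(List.ofFn fun c => (gen (x c) : Gamma M N)).prod,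
      (List.ofFn fun c => (gen (y c) : Gamma M N)).prod⁆
      = 1 := by
  have := PresentedGroup.one_of_mem (rels := gammaRels M N) (Or.inr ⟨(x, y), rfl⟩)
  simpa [gen, PresentedGroup.of, map_commutatorElement, map_list_prod, List.map_ofFn,
    Function.comp_def] using this

/-- The endomorphism `g_i ↦ g_{i + a}` of `Γ_{M,N}`. -/
def gammaShift (M N : ℕ) (a : ZMod M) : Gamma M N →* Gamma M N :=
  PresentedGroup.toGroup (f := fun i => gen (i + a)) (by
    rintro _ (⟨i, rfl⟩ | ⟨x, rfl⟩)
    · simp [gen_pow]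
    · simpa [map_commutatorElement, map_list_prod, List.map_ofFn, Function.comp_def] using
        gen_comm (fun c => x.1 c + a) (fun c => x.2 c + a))

@[simp]
theorem gammaShift_gen {M N : ℕ} (a i : ZMod M) :
    gammaShift M N a (gen i) = gen (i + a) := PresentedGroup.toGroup.of _

/-- The cyclic action of `ℤ_M = ⟨h⟩` on `Γ_{M,N}`, `h.g_i = g_{i + 1}`. The group `ℤ_M` is written
multiplicatively, with generator `h = Multiplicative.ofAdd 1`. -/
def cyclicAct (M N : ℕ) : Multiplicative (ZMod M) →* MulAut (Gamma M N) where
  toFun a :=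
    { toFun := gammaShift M N a.toAdd
      invFun := gammaShift M N (-a.toAdd)
      left_inv := fun x => DFunLike.congr_fun (PresentedGroup.ext (φ := (gammaShift M N
        (-a.toAdd)).comp (gammaShift M N a.toAdd)) (ψ := MonoidHom.id _) fun i => by
          change gammaShift M N _ (gammaShift M N _ (gen i)) = gen i
          simp) x
      right_inv := fun x => DFunLike.congr_fun (PresentedGroup.ext (φ := (gammaShift M N
        a.toAdd).comp (gammaShift M N (-a.toAdd))) (ψ := MonoidHom.id _) fun i => by
          change gammaShift M N _ (gammaShift M N _ (gen i)) = gen i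
          simp) x
      map_mul' := map_mul _ }
  map_one' := by
    ext x
    exact DFunLike.congr_fun (PresentedGroup.ext (φ := gammaShift M N 0) (ψ := MonoidHom.id _)
      fun i => by
        change gammaShift M N _ (gen i) = gen i
        simp) x
  map_mul' a b := by
    ext x
    exact DFunLike.congr_fun (PresentedGroup.ext (φ := gammaShift M N (a.toAdd + b.toAdd))
      (ψ := (gammaShift M N a.toAdd).comp (gammaShift M N b.toAdd))
      fun i => by
        change gammaShift M N _ (gen i) = gammaShift M N _ (gammaShift M N _ (gen i))
        simp [add_assoc, add_comm a.toAdd]) x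

@[simp]
theorem cyclicAct_gen {M N : ℕ} (a : Multiplicative (ZMod M)) (i : ZMod M) :
    cyclicAct M N a (gen i) = gen (i + a.toAdd) := gammaShift_gen _ _

/-- The product `g_0 g_1` in `Γ_{2,2} = ℤ_2 * ℤ_2`. -/
def rot : Gamma 2 2 := gen 0 * gen 1

theorem gen_mul_self (i : ZMod 2) : (gen i : Gamma 2 2) * gen i = 1 := by
  rw [← sq, gen_pow]

theorem gen_inv (i : ZMod 2) : (gen i : Gamma 2 2)⁻¹ = gen i :=
  inv_eq_of_mul_eq_one_left (gen_mul_self i)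

theorem rot_inv : rot⁻¹ = gen 1 * gen 0 := by
  rw [rot, mul_inv_rev, gen_inv, gen_inv]

theorem rot_conj (s : Gamma 2 2) : s * rot * s⁻¹ = rot ∨ s * rot * s⁻¹ = rot⁻¹ := by
  let K : Subgroup (Gamma 2 2) :=
    { carrier := {s | s * rot * s⁻¹ = rot ∨ s * rot * s⁻¹ = rot⁻¹}
      one_mem' := by simp
      mul_mem' := by
        intro a b ha hb
        have e : a * b * rot * (a * b)⁻¹ = a * (b * rot * b⁻¹) * a⁻¹ := by group
        have e' : a * rot⁻¹ * a⁻¹ = (a * rot * a⁻¹)⁻¹ := by group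
        simp only [Set.mem_ofPred_eq] at ha hb ⊢
        rw [e]
        rcases hb with hb | hb <;> rw [hb]
        · exact ha
        · rw [e']
          rcases ha with ha | ha <;> simp [ha]
      inv_mem' := by
        intro a ha
        simp only [Set.mem_ofPred_eq, inv_inv] at ha ⊢
        rcases ha with ha | ha
        · left
          nth_rw 1 [← ha]
          group
        · right
          have e' : a * rot⁻¹ * a⁻¹ = (a * rot * a⁻¹)⁻¹ := by group
          rw [ha, inv_inv] at e'
          have e : ∀ x : Gamma 2 2, a⁻¹ * (a * x * a⁻¹) * a = x := by intro x; group
          calc a⁻¹ * rot * a = a⁻¹ * (a * rot⁻¹ * a⁻¹) * a := by rw [e']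
            _ = rot⁻¹ := e _ }
  refine PresentedGroup.generated_by _ K (fun j => ?_) s
  change gen j * rot * (gen j)⁻¹ = rot ∨ gen j * rot * (gen j)⁻¹ = rot⁻¹
  right
  rw [rot_inv, gen_inv, rot]
  fin_cases j
  · change gen 0 * (gen 0 * gen 1) * gen 0 = gen 1 * gen 0
    rw [← mul_assoc, gen_mul_self, one_mul]
  · change gen 1 * (gen 0 * gen 1) * gen 1 = gen 1 * gen 0
    rw [mul_assoc, mul_assoc, gen_mul_self, mul_one]

theorem rot_act (a : Multiplicative (ZMod 2)) :
    cyclicAct 2 2 a rot = rot ∨ cyclicAct 2 2 a rot = rot⁻¹ := by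
  rw [rot_inv, rot, map_mul, cyclicAct_gen, cyclicAct_gen]
  obtain ⟨b, rfl⟩ := Multiplicative.ofAdd.surjective a
  fin_cases b
  · left; rfl
  · right; rfl

/-- The subgroup `N_m = ⟨(g_0 g_1)^m⟩` of `Γ_{2,2}`. -/
def rotSubgroup (m : ℕ) : Subgroup (Gamma 2 2) := Subgroup.zpowers (rot ^ m)

theorem rot_conj_zpow (m : ℕ) (s : Gamma 2 2) (n : ℤ) :
    s * (rot ^ m) ^ n * s⁻¹ = (rot ^ m) ^ n ∨ s * (rot ^ m) ^ n * s⁻¹ = (rot ^ m) ^ (-n) := by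
  rw [← conj_zpow, ← conj_pow]
  rcases rot_conj s with h | h <;> simp [h]

theorem rot_act_zpow (m : ℕ) (a : Multiplicative (ZMod 2)) (n : ℤ) :
    cyclicAct 2 2 a ((rot ^ m) ^ n) = (rot ^ m) ^ n ∨
      cyclicAct 2 2 a ((rot ^ m) ^ n) = (rot ^ m) ^ (-n) := by
  rw [map_zpow, map_pow]
  rcases rot_act a with h | h <;> simp [h]

instance rotSubgroup_normal (m : ℕ) : (rotSubgroup m).Normal where
  conj_mem := by
    rintro _ ⟨n, rfl⟩ s
    rcases rot_conj_zpow m s n with h | h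
    · exact ⟨n, h.symm⟩
    · exact ⟨-n, h.symm⟩

theorem rotSubgroup_stable (m : ℕ) (a : Multiplicative (ZMod 2)) :
    ∀ r ∈ rotSubgroup m, cyclicAct 2 2 a r ∈ rotSubgroup m := by
  rintro _ ⟨n, rfl⟩
  rcases rot_act_zpow m a n with h | h
  · exact ⟨n, h.symm⟩
  · exact ⟨-n, h.symm⟩

/-- `Γ_{2,2}` maps to the infinite dihedral group. -/
def gammaToDihedral : Gamma 2 2 →* DihedralGroup 0 :=
  PresentedGroup.toGroup (f := fun i : ZMod 2 => DihedralGroup.sr (i.val : ZMod 0)) (by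
    rintro _ (⟨i, rfl⟩ | ⟨x, rfl⟩)
    · simp [sq]
    · simp [List.ofFn_succ, commutatorElement_def]
      rw [DihedralGroup.one_def]
      congr 1
      ring)

theorem rot_pow_injective {m : ℕ} (hm : 0 < m) :
    Function.Injective fun n : ℤ => (rot ^ m) ^ n := by
  have h : ∀ n : ℤ, gammaToDihedral ((rot ^ m) ^ n) = DihedralGroup.r ((m : ZMod 0) * (Int.cast n : ZMod 0)) := by
    intro n
    have : gammaToDihedral rot = DihedralGroup.r 1 := by
      rw [rot, map_mul]
      change gammaToDihedral (PresentedGroup.of 0) * gammaToDihedral (PresentedGroup.of 1) = _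
      rw [gammaToDihedral, PresentedGroup.toGroup.of, PresentedGroup.toGroup.of]
      rfl
    rw [map_zpow, map_pow, this, ← zpow_natCast, ← zpow_mul, DihedralGroup.r_one_zpow, Int.cast_mul,
      Int.cast_natCast]
  intro n n' e
  have e' := congrArg gammaToDihedral e
  simp only [h] at e'
  have : (m * n : ℤ) = m * n' := by
    have e2 : (Int.cast (m * n : ℤ) : ZMod 0) = Int.cast (m * n' : ℤ) := by
      rw [Int.cast_mul, Int.cast_mul]
      exact DihedralGroup.r.inj e'
    exact Int.modEq_zero_iff.1 ((ZMod.intCast_eq_intCast_iff _ _ 0).1 e2)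
  exact mul_left_cancel₀ (by exact_mod_cast hm.ne') this

/-- `N_m` is infinite cyclic for `m ≥ 1`. -/
def rotEquiv {m : ℕ} (hm : 0 < m) : Multiplicative ℤ ≃* rotSubgroup m :=
  MulEquiv.ofBijective
    (zpowersHom (rotSubgroup m) ⟨rot ^ m, Subgroup.mem_zpowers _⟩)
    ⟨fun a b e => Multiplicative.toAdd.injective
      (rot_pow_injective hm (by simpa [Subtype.ext_iff] using e)), by
      rintro ⟨_, n, rfl⟩
      exact ⟨Multiplicative.ofAdd n, Subtype.ext (by simp)⟩⟩

variable (k : Type*) [Field k]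

/-- The character `χ` of `ℤ_2 = ⟨h⟩` with `χ(h) = -1`, as an element of `(k^{ℤ_2})ˣ`. -/
def chi : Multiplicative (ZMod 2) → kˣ := fun y => if y = 1 then 1 else -1

/-- For `m ≥ 1`, the morphism `Φ_m : N_m → (k^{ℤ_2})ˣ` with `Φ_m ((g_0 g_1)^m) = χ`. -/
def rotPhi {m : ℕ} (hm : 0 < m) : rotSubgroup m →* (Multiplicative (ZMod 2) → kˣ) :=
  (zpowersHom _ (chi k)).comp (rotEquiv hm).symm.toMonoidHom

theorem rotPhi_zpow {m : ℕ} (hm : 0 < m) (n : ℤ) (h : (rot ^ m) ^ n ∈ rotSubgroup m) :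
    rotPhi k hm ⟨(rot ^ m) ^ n, h⟩ = chi k ^ n := by
  have : (⟨(rot ^ m) ^ n, h⟩ : rotSubgroup m) = rotEquiv hm (Multiplicative.ofAdd n) :=
    Subtype.ext (by
      change (rot ^ m) ^ n = ((zpowersHom (rotSubgroup m) ⟨rot ^ m, Subgroup.mem_zpowers _⟩)
        (Multiplicative.ofAdd n) : rotSubgroup m)
      simp)
  rw [this]
  simp [rotPhi]

theorem chi_inv : (chi k)⁻¹ = chi k := by
  funext y
  by_cases h : y = 1 <;> simp [chi, h]

theorem chi_mul (y z : Multiplicative (ZMod 2)) : chi k (y * z) = chi k y * chi k z := by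
  obtain ⟨b, rfl⟩ := Multiplicative.ofAdd.surjective y
  obtain ⟨d, rfl⟩ := Multiplicative.ofAdd.surjective z
  have h1 : (Multiplicative.ofAdd (1 : ZMod 2)) ≠ 1 := by decide
  have h2 : (Multiplicative.ofAdd (1 : ZMod 2)) * Multiplicative.ofAdd 1 = 1 := by decide
  fin_cases b <;> fin_cases d
  · change chi k (1 * 1) = chi k 1 * chi k 1
    simp [chi]
  · change chi k (1 * Multiplicative.ofAdd 1) = chi k 1 * chi k (Multiplicative.ofAdd 1)
    simp [chi]
  · change chi k (Multiplicative.ofAdd 1 * 1) = chi k (Multiplicative.ofAdd 1) * chi k 1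
    simp [chi]
  · change chi k (Multiplicative.ofAdd 1 * Multiplicative.ofAdd 1)
      = chi k (Multiplicative.ofAdd 1) * chi k (Multiplicative.ofAdd 1)
    rw [h2]
    simp [chi, h1]

theorem chi_zpow_neg (n : ℤ) : chi k ^ (-n) = chi k ^ n := by
  rw [zpow_neg, ← inv_zpow, chi_inv]

/-- The quotient datum `(N_m, Φ_m)`. -/
def rotDatum {m : ℕ} (hm : 0 < m) : QuotientDatum k (cyclicAct 2 2) where
  N := rotSubgroup m
  normal := rotSubgroup_normal m
  stable := rotSubgroup_stable m
  Φ := rotPhi k hm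
  Φ_mul := by
    rintro ⟨r, hr⟩ l h
    obtain ⟨n, rfl⟩ := Subgroup.mem_zpowers_iff.1 hr
    have e : rotPhi k hm ⟨cyclicAct 2 2 l⁻¹ ((rot ^ m) ^ n), rotSubgroup_stable m _ _ ⟨n, rfl⟩⟩
        = chi k ^ n := by
      rcases rot_act_zpow m l⁻¹ n with h | h
      · simp only [h, rotPhi_zpow]
      · simp only [h, rotPhi_zpow, chi_zpow_neg]
    simp only [e, rotPhi_zpow, Pi.pow_apply, chi_mul, mul_zpow]
    rw [mul_comm]
  Φ_conj := by
    rintro ⟨r, hr⟩ s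
    obtain ⟨n, rfl⟩ := Subgroup.mem_zpowers_iff.1 hr
    rcases rot_conj_zpow m s n with h | h
    · simp only [h, rotPhi_zpow]
    · simp only [h, rotPhi_zpow, chi_zpow_neg]

/-- The Hopf algebra `A(m) = k[Γ_{2,2} / N_m] ⋊ k^{ℤ_2}`. -/
abbrev HopfA (m : ℕ) :=
  SmashCoproduct k (quotientAct (cyclicAct 2 2) (rotSubgroup m) (rotSubgroup_stable m))

/-- The Hopf algebra `B(m) = k[Γ_{2,2} / N_m] ⋊_{Φ_m} k^{ℤ_2}`, for `m ≥ 1`, written with the help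
of a section `s` of the projection `Γ_{2,2} → Γ_{2,2} / N_m` with `s 1 = 1` (up to isomorphism it
does not depend on `s`). -/
abbrev HopfB {m : ℕ} (hm : 0 < m) (s : NormalizedSection (rotSubgroup m)) :=
  TwistedSmash ((rotDatum k hm).cocycle s)

end Gamma

section Representation

variable {k : Type*} [Field k]

/-- The matrix `θ_{ic} = Q_{i-1,c} Q_{i,c-1} / (Q_{ic} Q_{i-1,c-1})` attached to `Q`, with indices
modulo `2`. -/
def theta (Q : ZMod 2 → ZMod 2 → kˣ) (i c : ZMod 2) : kˣ :=
  Q (i - 1) c * Q i (c - 1) / (Q i c * Q (i - 1) (c - 1))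

/-- The parameter matrix `Q` with rows `(1, 1)` and `(1, q)`. -/
def paramQ (q : kˣ) (i c : ZMod 2) : kˣ := if i = 1 ∧ c = 1 then q else 1

/-- The matrix of the endomorphism `ε_c ↦ θ_{ic} ε_{c-1}` of `k^2`. -/
def genMatrix (q : kˣ) (i : ZMod 2) : Matrix (ZMod 2) (ZMod 2) k :=
  Matrix.of fun d c => if d = c - 1 then (theta (paramQ q) i c : k) else 0

theorem genMatrix_mul (q : kˣ) (i j : ZMod 2) : genMatrix q i * genMatrix q j =
    Matrix.diagonal fun c => (theta (paramQ q) i (c - 1) : k) * theta (paramQ q) j c := by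
  ext d c
  have h : ∀ c : ZMod 2, c - 1 - 1 = c := by decide
  simp only [genMatrix, Matrix.mul_apply, Matrix.of_apply, Matrix.diagonal_apply]
  rw [Finset.sum_eq_single (c - 1)]
  · by_cases e : d = c <;> simp [h, e]
  · intro x _ hx
    simp [hx]
  · simp

theorem genMatrix_sq (q : kˣ) (i : ZMod 2) : genMatrix q i * genMatrix q i = 1 := by
  rw [genMatrix_mul, ← Matrix.diagonal_one]
  congr 1
  funext c
  have h : ∀ c : ZMod 2, c - 1 - 1 = c := by decide
  rw [← Units.val_mul, theta, theta, h, mul_comm (paramQ q i c), mul_comm (paramQ q i (c - 1)),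
    div_mul_div_cancel, div_self', Units.val_one]

/-- The matrix `genMatrix q i` as an invertible matrix. -/
def genUnit (q : kˣ) (i : ZMod 2) : (Matrix (ZMod 2) (ZMod 2) k)ˣ :=
  ⟨genMatrix q i, genMatrix q i, genMatrix_sq q i, genMatrix_sq q i⟩

/-- The representation of `Γ_{2,2}` on `k^2` with `g_i : ε_c ↦ θ_{ic} ε_{c-1}`. -/
def gammaRep (q : kˣ) : Gamma 2 2 →* (Matrix (ZMod 2) (ZMod 2) k)ˣ :=
  PresentedGroup.toGroup (f := genUnit q) (by
    rintro _ (⟨i, rfl⟩ | ⟨x, rfl⟩)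
    · ext1
      simp [sq, genUnit, genMatrix_sq]
    · dsimp only
      rw [map_commutatorElement, commutatorElement_eq_one_iff_mul_comm]
      simp only [List.ofFn_succ, map_mul, FreeGroup.lift_apply_of, List.ofFn_zero, List.prod_cons, List.prod_nil, mul_one]
      apply Units.ext
      simp only [Units.val_mul, genUnit, genMatrix_mul, Matrix.diagonal_mul_diagonal]
      congr 1
      funext c
      exact mul_comm _ _)

/-- The representation `ρ_q : k[Γ_{2,2}] ⋊ k^{ℤ_2} → M_2(k) = End(k^2)`, with
`ρ_q (g_i # 1) (ε_c) = θ_{ic} ε_{c-1}` and `ρ_q (1 # f) = f(h) id`, where `ℤ_2 = ⟨h⟩`. -/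
def rho (q : kˣ) : SmashCoproduct k (cyclicAct 2 2) →ₐ[k] Matrix (ZMod 2) (ZMod 2) k :=
  smashRep ((Units.coeHom _).comp (gammaRep q)) (Multiplicative.ofAdd 1)

end Representation

end

/-!
Convolution makes the dual of a Hopf algebra `L` an algebra, and the coefficients of a
representation `φ` of `L` generate a subalgebra of it. If this subalgebra separates the elements of
`L`, then no proper quotient Hopf algebra of `L` carries `φ`, so a factorization `φ ∘ p` is the Hopf
image. For `k[Q] ⋊ k^H` the functionals supported on `h = 1` form the algebra of all functions on
`Q`, and there it suffices, as in the Stone-Weierstrass theorem, to separate the points of `Q`.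

The product `g₀ g₁` acts on `k²` through a diagonal matrix with entries `q ^ 2` and `q ^ (-2)`. The
squares of the entries in the first row are among the functions obtained from `ρ_q`, and they
determine an element of `Γ₂,₂` exactly up to `N_m` for `m = o(q⁴)`. Finally `(g₀ g₁) ^ m` acts as
the scalar `q ^ (2 m) = ± 1`, and the sign decides between `A(m)` and `B(m)`.
-/

noncomputable section

section HopfImage

open WithConv

section Coefficients

variable {k C D M : Type*} [CommRing k] [AddCommGroup C] [Module k C] [Coalgebra k C]
  [AddCommGroup D] [Module k D] [Coalgebra k D] [AddCommGroup M] [Module k M]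

/-- Precomposition with a coalgebra map, as a map of convolution algebras. -/
def dualMap (p : C →ₗc[k] D) : WithConv (D →ₗ[k] k) →ₐ[k] WithConv (C →ₗ[k] k) :=
  AlgHom.ofLinearMap
    { toFun := fun T => toConv (T.ofConv ∘ₗ p.toLinearMap)
      map_add' := fun _ _ => rfl
      map_smul' := fun _ _ => rfl }
    (by ext x; simp)
    (fun S T => congrArg toConv (LinearMap.convMul_comp_coalgHom_distrib S T p))

/-- The subalgebra of the convolution algebra `C → k` generated by the coefficients `f ∘ φ` of a
linear map `φ`. -/
def coeffAlgebra (φ : C →ₗ[k] M) : Subalgebra k (WithConv (C →ₗ[k] k)) :=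
  Algebra.adjoin k (Set.range fun f : M →ₗ[k] k => toConv (f ∘ₗ φ))

theorem coeff_mem_coeffAlgebra (φ : C →ₗ[k] M) (f : M →ₗ[k] k) :
    toConv (f ∘ₗ φ) ∈ coeffAlgebra φ :=
  Algebra.subset_adjoin ⟨f, rfl⟩

theorem coeffAlgebra_comp (φ : D →ₗ[k] M) (p : C →ₗc[k] D) :
    coeffAlgebra (φ ∘ₗ p.toLinearMap) = (coeffAlgebra φ).map (dualMap p) := by
  rw [coeffAlgebra, coeffAlgebra, AlgHom.map_adjoin, ← Set.range_comp]
  rfl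

/-- The generated coefficient algebra of `φ` separates the elements of `C`; for a representation of
a Hopf algebra this is inner faithfulness. -/
def CoeffsSeparate (φ : C →ₗ[k] M) : Prop :=
  ∀ x, (∀ T ∈ coeffAlgebra φ, T x = 0) → x = 0

theorem CoeffsSeparate.eq_zero_of_factorization {D' : Type*} [AddCommGroup D'] [Module k D']
    [Coalgebra k D'] {φ : D →ₗ[k] M} (hφ : CoeffsSeparate φ) {ψ : D' →ₗ[k] M} {p : C →ₗc[k] D}
    {p' : C →ₗc[k] D'} (h : φ ∘ₗ p.toLinearMap = ψ ∘ₗ p'.toLinearMap) {x : C} (hx : p' x = 0) :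
    p x = 0 := by
  refine hφ _ fun T hT => ?_
  have hTp : dualMap p T ∈ (coeffAlgebra ψ).map (dualMap p') := by
    rw [← coeffAlgebra_comp, ← h, coeffAlgebra_comp]
    exact ⟨T, hT, rfl⟩
  obtain ⟨T', -, hT'⟩ := hTp
  calc T (p x) = dualMap p T x := rfl
    _ = dualMap p' T' x := by rw [← hT']; rfl
    _ = T' (p' x) := rfl
    _ = 0 := by rw [hx, map_zero]

end Coefficients

theorem exists_bialgHom_descent {k A B C : Type*} [CommRing k] [Ring A] [Bialgebra k A] [Ring B]
    [Bialgebra k B] [Ring C] [Bialgebra k C] (p : A →ₐc[k] B) (hp : Function.Surjective p)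
    (g : A →ₐc[k] C) (h : ∀ x, p x = 0 → g x = 0) : ∃ f : B →ₐc[k] C, ∀ a, f (p a) = g a := by
  let p₁ : A →ₐ[k] B := p
  let g₁ : A →ₐ[k] C := g
  let f : B →ₐ[k] C := (Ideal.Quotient.liftₐ (RingHom.ker p₁) g₁ h).comp
    (Ideal.quotientKerAlgEquivOfSurjective hp).symm.toAlgHom
  have hf : f.comp p₁ = g₁ := AlgHom.ext fun a => congrArg (Ideal.Quotient.liftₐ _ g₁ h)
    (Ideal.quotientKerAlgEquivOfSurjective_symm_apply (f := p₁) hp a)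
  refine ⟨BialgHom.ofAlgHom f ?_ ?_, fun a => DFunLike.congr_fun hf a⟩
  · rw [← AlgHom.cancel_right (f := p₁) hp, AlgHom.comp_assoc, hf, BialgHom.counitAlgHom_comp,
      BialgHom.counitAlgHom_comp]
  · rw [← AlgHom.cancel_right (f := p₁) hp, AlgHom.comp_assoc, AlgHom.comp_assoc, hf,
      ← BialgHom.map_comp_comulAlgHom, ← BialgHom.map_comp_comulAlgHom, ← AlgHom.comp_assoc,
      ← Algebra.TensorProduct.map_comp, hf]

namespace IsHopfFactorization

variable {k : Type u} [Field k] {A : Type v} [Ring A] [HopfAlgebra k A] {R : Type*} [Ring R]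
  [Algebra k R] {ρ : A →ₐ[k] R} {L L' : Type*} [Ring L] [HopfAlgebra k L] [Ring L']
  [HopfAlgebra k L'] {p : A →ₐc[k] L} {φ : L →ₐ[k] R} {p' : A →ₐc[k] L'} {ψ : L' →ₐ[k] R}

theorem eq_zero_of_eq_zero (h : IsHopfFactorization ρ p φ) (hφ : CoeffsSeparate φ.toLinearMap)
    (h' : IsHopfFactorization ρ p' ψ) {x : A} (hx : p' x = 0) : p x = 0 :=
  hφ.eq_zero_of_factorization (ψ := ψ.toLinearMap) (p := (p : A →ₗc[k] L))
    (p' := (p' : A →ₗc[k] L')) (LinearMap.ext fun a => (h.2 a).trans (h'.2 a).symm) hx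

theorem isHopfImage (h : IsHopfFactorization ρ p φ) (hφ : CoeffsSeparate φ.toLinearMap) :
    IsHopfImage ρ p φ := by
  refine ⟨h, fun L' _ _ p' ψ h' => ?_⟩
  obtain ⟨f, hf⟩ := exists_bialgHom_descent p' h'.1 p fun _ => h.eq_zero_of_eq_zero hφ h'
  refine ⟨f, ⟨hf, h'.1.forall.2 fun a => ?_⟩, fun g hg => BialgHom.ext (h'.1.forall.2 fun a => ?_)⟩
  · rw [hf, h.2, h'.2]
  · rw [hf, hg.1]

theorem nonempty_bialgEquiv {L : Type v} [Ring L] [HopfAlgebra k L] {p : A →ₐc[k] L}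
    {φ : L →ₐ[k] R} (h : IsHopfFactorization ρ p φ) (hφ : CoeffsSeparate φ.toLinearMap)
    (h' : IsHopfImage ρ p' ψ) : Nonempty (L' ≃ₐc[k] L) := by
  obtain ⟨f, ⟨hf, -⟩, -⟩ := h'.2 L p φ h
  have f_injective : Function.Injective f :=
    (injective_iff_map_eq_zero f).2 <| h.1.forall.2 fun x hx =>
      h.eq_zero_of_eq_zero hφ h'.1 (by rw [← hf, hx])
  have f_surjective : Function.Surjective f := .of_comp (g := p) (by
    convert h'.1.1 using 1
    exact funext hf)
  exact ⟨(BialgEquiv.ofBijective f ⟨f_injective, f_surjective⟩).symm⟩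

end IsHopfFactorization

end HopfImage

theorem exists_mem_subalgebra_vanishing {k X : Type*} [Field k] (S : Subalgebra k (X → k)) {a : X}
    (hS : ∀ b, b ≠ a → ∃ v ∈ S, v a ≠ v b) (F : Finset X) :
    ∃ w ∈ S, w a ≠ 0 ∧ ∀ b ∈ F, b ≠ a → w b = 0 := by
  choose! v hv hva using hS
  classical
  refine ⟨∏ b ∈ F.erase a, (v b - algebraMap k _ (v b b)), prod_mem fun b hb => sub_mem
    (hv b (Finset.ne_of_mem_erase hb)) (algebraMap_mem S _), ?_, fun b hb hba => ?_⟩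
  · rw [Finset.prod_apply, Finset.prod_ne_zero_iff]
    exact fun b hb => sub_ne_zero.2 (hva b (Finset.ne_of_mem_erase hb))
  · rw [Finset.prod_apply]
    exact Finset.prod_eq_zero (Finset.mem_erase.2 ⟨hba, hb⟩) (sub_self _)

namespace TwistedSmash

open WithConv

variable {k Q H : Type*} [Field k] [Group Q] [Group H] {act : H →* MulAut Q}
  (c : SmashCocycle k act) [Fintype H] [DecidableEq H]

/-- The functional on `TwistedSmash c` which is `u` on the elements `a # δ_h` with the given `h`,
and `0` on the other basis elements. -/
def pointFun (u : Q → k) (h : H) : WithConv (TwistedSmash c →ₗ[k] k) :=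
  toConv (lift c fun a l => if l = h then u a else 0)

theorem pointFun_elt (u : Q → k) (h : H) (a : Q) (l : H) :
    pointFun c u h (elt c a l) = if l = h then u a else 0 :=
  lift_elt c (fun a l => if l = h then u a else 0) a l

theorem pointFun_mul_pointFun (u v : Q → k) (h l : H) : pointFun c u h * pointFun c v l
    = pointFun c (fun a => c.τ h⁻¹ a l * (u a * v (act h⁻¹ a))) (h * l) := by
  refine ofConv_injective (lin_ext fun a m => ?_)
  change (pointFun c u h * pointFun c v l) (elt c a m) = pointFun c _ (h * l) (elt c a m)
  rw [LinearMap.convMul_apply, comul_elt, pointFun_elt]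
  simp only [map_sum, map_smul, TensorProduct.map_tmul, LinearMap.mul'_apply, smul_eq_mul]
  rw [Finset.sum_eq_single h⁻¹]
  · change _ * (pointFun c u h (elt c a _) * pointFun c v l (elt c _ _)) = _
    by_cases hm : m = h * l
    · subst hm
      simp [pointFun_elt]
    · simp [pointFun_elt, hm, inv_mul_eq_iff_eq_mul]
  · intro n _ hn
    change _ * (pointFun c u h (elt c a _) * pointFun c v l (elt c _ _)) = _
    simp [pointFun_elt, inv_eq_iff_eq_inv, hn]
  · simp

/-- The embedding `u ↦ pointFun c u 1` of the functions on `Q` into the dual algebra. -/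
def pointFunOne : (Q → k) →ₐ[k] WithConv (TwistedSmash c →ₗ[k] k) :=
  AlgHom.ofLinearMap
    { toFun := fun u => pointFun c u 1
      map_add' := fun u v => ofConv_injective <| lin_ext fun a h => by
        change pointFun c (u + v) 1 (elt c a h)
          = pointFun c u 1 (elt c a h) + pointFun c v 1 (elt c a h)
        simp only [pointFun_elt]
        split_ifs <;> simp
      map_smul' := fun r u => ofConv_injective <| lin_ext fun a h => by
        change pointFun c (r • u) 1 (elt c a h) = r • pointFun c u 1 (elt c a h)
        simp [pointFun_elt] }
    (ofConv_injective <| lin_ext fun a h => by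
      change pointFun c 1 1 (elt c a h) = (1 : WithConv (TwistedSmash c →ₗ[k] k)) (elt c a h)
      simp [pointFun_elt, counit_elt])
    (fun u v => by
      change pointFun c (u * v) 1 = pointFun c u 1 * pointFun c v 1
      simp [pointFun_mul_pointFun, c.τ_one_left, ← Pi.mul_def])

theorem pointFun_one_one : pointFun c 1 1 = 1 := map_one (pointFunOne c)

theorem pointFunOne_mul_pointFun (u v : Q → k) (h : H) :
    pointFunOne c u * pointFun c v h = pointFun c (u * v) h := by
  change pointFun c u 1 * pointFun c v h = _
  simp [pointFun_mul_pointFun, c.τ_one_left, ← Pi.mul_def]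

theorem pointFun_apply_eq_repr_mul {u : Q → k} {x : TwistedSmash c} {a : Q}
    (hu : ∀ i ∈ ((basis c).repr x).support, i.1 ≠ a → u i.1 = 0) (h : H) :
    pointFun c u h x = (basis c).repr x (a, h) * u a := by
  change (basis c).constr k (fun i => if i.2 = h then u i.1 else 0) x = _
  rw [Module.Basis.constr_apply, Finsupp.sum, Finset.sum_eq_single (a, h)]
  · simp
  · rintro ⟨b, l⟩ hbl hne
    by_cases hl : l = h
    · subst hl
      simp [hu _ hbl fun hb => hne (by rw [← hb])]
    · simp [hl]
  · intro ha
    simp [Finsupp.notMem_support_iff.1 ha]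

theorem eq_zero_of_forall_mem_subalgebra (S : Subalgebra k (WithConv (TwistedSmash c →ₗ[k] k)))
    (hsep : ∀ a b, b ≠ a → ∃ v, pointFun c v 1 ∈ S ∧ v a ≠ v b)
    (hne : ∀ a h, ∃ u, pointFun c u h ∈ S ∧ u a ≠ 0) {x : TwistedSmash c}
    (hx : ∀ T ∈ S, T x = 0) : x = 0 := by
  classical
  refine (basis c).repr.map_eq_zero_iff.1 (Finsupp.ext fun ⟨a, h⟩ => ?_)
  obtain ⟨w, hwS, hwa, hw⟩ := exists_mem_subalgebra_vanishing (S.comap (pointFunOne c)) (hsep a)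
    (((basis c).repr x).support.image Prod.fst)
  obtain ⟨u, huS, hua⟩ := hne a h
  have hwu : pointFun c (w * u) h ∈ S := by
    rw [← pointFunOne_mul_pointFun]
    exact mul_mem hwS huS
  have hcoord : (basis c).repr x (a, h) * (w * u) a = 0 := by
    rw [← pointFun_apply_eq_repr_mul c (u := w * u) (fun i hi hia => by
      rw [Pi.mul_apply, hw i.1 (Finset.mem_image_of_mem _ hi) hia, zero_mul]) h]
    exact hx _ hwu
  exact (mul_eq_zero.1 hcoord).resolve_right (mul_ne_zero hwa hua)

end TwistedSmash

namespace TwistedSmash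

variable {k Q H : Type*} [Field k] [Group Q] [Group H] {act : H →* MulAut Q}
  (c : SmashCocycle k act) [Fintype H] [DecidableEq H]

/-- An algebra map out of `TwistedSmash c` from its values on the elements `a # δ_h`. -/
def liftAlgHom {R : Type*} [Ring R] [Algebra k R] (F : Q → H → R) (F_one : ∑ h, F 1 h = 1)
    (F_mul : ∀ a h b l, F a h * F b l = if h = l then c.σ a b h • F (a * b) h else 0) :
    TwistedSmash c →ₐ[k] R :=
  AlgHom.ofLinearMap (lift c F) (by simp only [one_def, map_sum, lift_elt, F_one]) <| by
    have h : (LinearMap.mul k (TwistedSmash c)).compr₂ (lift c F)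
        = (LinearMap.mul k R).compl₁₂ (lift c F) (lift c F) :=
      bilin_ext c fun a h b l => by
        simp only [LinearMap.compr₂_apply, LinearMap.compl₁₂_apply, LinearMap.mul_apply',
          elt_mul_elt, lift_elt, F_mul]
        split_ifs <;> simp
    exact LinearMap.congr_fun₂ h

@[simp]
theorem liftAlgHom_elt {R : Type*} [Ring R] [Algebra k R] {F : Q → H → R} (F_one F_mul) (a : Q)
    (h : H) : liftAlgHom c F F_one F_mul (elt c a h) = F a h :=
  lift_elt c F a h

/-- The representation of `TwistedSmash c` supported at a point `y` of `H` and attached to a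
projective representation `M` of `Q` whose cocycle is the value of `σ` at `y`. -/
def projectiveRep {R : Type*} [Ring R] [Algebra k R] (M : Q → R) (y : H) (M_one : M 1 = 1)
    (M_mul : ∀ a b, M a * M b = c.σ a b y • M (a * b)) : TwistedSmash c →ₐ[k] R :=
  liftAlgHom c (fun a h => if h = y then M a else 0) (by simp [M_one]) fun a h b l => by
    by_cases hy : h = y
    · subst hy
      by_cases hl : h = l
      · subst hl
        simp [M_mul]
      · simp [hl, Ne.symm hl]
    · simp [hy]

@[simp]
theorem projectiveRep_elt {R : Type*} [Ring R] [Algebra k R] {M : Q → R} {y : H} (M_one M_mul)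
    (a : Q) (h : H) :
    projectiveRep c M y M_one M_mul (elt c a h) = if h = y then M a else 0 :=
  liftAlgHom_elt c _ _ a h

theorem finite_iff : Module.Finite k (TwistedSmash c) ↔ Finite Q := by
  refine ⟨fun _ => ?_, fun _ => .of_basis (basis c)⟩
  have := Module.Finite.finite_basis (basis c)
  exact Finite.prod_left H

theorem finrank_eq : Module.finrank k (TwistedSmash c) = Nat.card Q * Nat.card H := by
  rw [Module.finrank_eq_nat_card_basis (basis c), Nat.card_prod]

end TwistedSmash

theorem smashRep_elt {k Γ H : Type*} [Field k] [Group Γ] [Group H] [Fintype H] [DecidableEq H]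
    {act : H →* MulAut Γ} {R : Type*} [Ring R] [Algebra k R] (π : Γ →* R) (y : H) (r : Γ) (h : H) :
    smashRep (k := k) (act := act) π y (TwistedSmash.elt _ r h) = if h = y then π r else 0 :=
  TwistedSmash.lift_elt _ (fun r h => if h = y then π r else 0) r h

/-- A morphism of structure constants: a homomorphism of the groups, equivariant for the actions of
`H`, together with a function `scale` which transforms the structure constants into each other. -/
structure SmashCocycle.Hom {k Q Q' H : Type*} [Field k] [Group Q] [Group Q'] [Group H]
    {act : H →* MulAut Q} {act' : H →* MulAut Q'} (c : SmashCocycle k act)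
    (c' : SmashCocycle k act') where
  toHom : Q →* Q'
  scale : Q → H → k
  map_act : ∀ h a, toHom (act h a) = act' h (toHom a)
  scale_one : ∀ h, scale 1 h = 1
  scale_counit : ∀ a, scale a 1 = 1
  scale_σ : ∀ a b h,
    c.σ a b h * scale (a * b) h = scale a h * scale b h * c'.σ (toHom a) (toHom b) h
  scale_τ : ∀ l a h, c.τ l a (l * h) * (scale a l⁻¹ * scale (act l a) (l * h))
    = scale a h * c'.τ l (toHom a) (l * h)

namespace TwistedSmash

variable {k Q Q' H : Type*} [Field k] [Group Q] [Group Q'] [Group H] {act : H →* MulAut Q}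
  {act' : H →* MulAut Q'} {c : SmashCocycle k act} {c' : SmashCocycle k act'}
  [Fintype H] [DecidableEq H]

/-- The bialgebra map `a # δ_h ↦ F.scale a h • (F.toHom a # δ_h)` induced by a morphism `F` of
structure constants. -/
def map (F : c.Hom c') : TwistedSmash c →ₐc[k] TwistedSmash c' :=
  let f := liftAlgHom c (fun a h => F.scale a h • elt c' (F.toHom a) h)
    (by simp [F.scale_one, one_def]) fun a h b l => by
      rw [smul_mul_smul_comm, elt_mul_elt]
      split_ifs with hl
      · subst hl
        rw [smul_smul, smul_smul, F.scale_σ, map_mul]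
      · rw [smul_zero]
  { f with
    map_smul' := map_smul f
    counit_comp := lin_ext fun a h => by
      change Coalgebra.counit (R := k) (f (elt c a h)) = Coalgebra.counit (R := k) (elt c a h)
      rw [liftAlgHom_elt, map_smul, counit_elt, counit_elt]
      split_ifs with hh
      · rw [hh, F.scale_counit, one_smul]
      · rw [smul_zero]
    map_comp_comul := lin_ext fun a h => by
      change TensorProduct.map f.toLinearMap f.toLinearMap (Coalgebra.comul (R := k) (elt c a h))
        = Coalgebra.comul (R := k) (f (elt c a h))
      rw [liftAlgHom_elt, map_smul, comul_elt, comul_elt, map_sum, Finset.smul_sum]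
      refine Finset.sum_congr rfl fun l _ => ?_
      rw [map_smul, TensorProduct.map_tmul, AlgHom.toLinearMap_apply, AlgHom.toLinearMap_apply,
        liftAlgHom_elt, liftAlgHom_elt, F.map_act, TensorProduct.smul_tmul_smul, smul_smul,
        smul_smul, F.scale_τ] }

theorem map_elt (F : c.Hom c') (a : Q) (h : H) :
    map F (elt c a h) = F.scale a h • elt c' (F.toHom a) h :=
  lift_elt c (fun a h => F.scale a h • elt c' (F.toHom a) h) a h

end TwistedSmash

namespace QuotientDatum

open TwistedSmash WithConv

variable {k Γ H : Type*} [Field k] [Group Γ] [Group H] {act : H →* MulAut Γ}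
  (D : QuotientDatum k act) (s : NormalizedSection D.N)

theorem cocycle_σ (a b : Γ ⧸ D.N) :
    (D.cocycle s).σ a b = fun h => (D.ext (s.j a * s.j b * (s.j (a * b))⁻¹) h : k) := by
  rw [← D.Φ_eq _ (D.mem_σ s a b)]
  rfl

theorem cocycle_τ (l : H) (a : Γ ⧸ D.N) : (D.cocycle s).τ l a
    = fun h => (D.ext (act l (s.j a) * (s.j (quotientAct act D.N D.stable l a))⁻¹) h : k) := by
  rw [← D.Φ_eq _ (D.mem_τ s l a)]
  rfl

theorem mul_section_inv_mem (r : Γ) : r * (s.j r)⁻¹ ∈ D.N := by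
  rw [← QuotientGroup.eq_one_iff]
  simp [s.mk_j]

theorem ext_section_mul (r t : Γ) (h : H) :
    D.ext (r * t * (s.j (r * t : Γ))⁻¹) h = D.ext (r * (s.j r)⁻¹) h * D.ext (t * (s.j t)⁻¹) h
      * D.ext (s.j r * s.j t * (s.j ((r : Γ ⧸ D.N) * t))⁻¹) h := by
  have hr := D.mul_section_inv_mem s r
  have ht := D.mul_section_inv_mem s t
  have ht' := D.normal.conj_mem _ ht (s.j r)
  have e : r * t * (s.j (r * t : Γ))⁻¹ = r * (s.j r)⁻¹ * (s.j r * (t * (s.j t)⁻¹) * (s.j r)⁻¹)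
      * (s.j r * s.j t * (s.j ((r : Γ ⧸ D.N) * t))⁻¹) := by
    rw [QuotientGroup.mk_mul]
    group
  rw [e, D.ext_mul (mul_mem hr ht') (D.mem_σ s r t), D.ext_mul hr ht', D.ext_conj ht]
  rfl

theorem ext_section_act (l : H) (r : Γ) (h : H) :
    D.ext (r * (s.j r)⁻¹) l⁻¹ * D.ext (act l r * (s.j (act l r : Γ))⁻¹) (l * h)
      = D.ext (r * (s.j r)⁻¹) h
        * D.ext (act l (s.j r) * (s.j (quotientAct act D.N D.stable l r))⁻¹) (l * h) := by
  have hr := D.mul_section_inv_mem s r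
  have e : act l r * (s.j (act l r : Γ))⁻¹ = act l (r * (s.j r)⁻¹)
      * (act l (s.j r) * (s.j (quotientAct act D.N D.stable l r))⁻¹) := by
    rw [quotientAct_mk, map_mul, map_inv]
    group
  rw [e, D.ext_mul (D.stable l _ hr) (D.mem_τ s l r), Pi.mul_apply, ← mul_assoc,
    mul_comm (D.ext _ l⁻¹), D.ext_shift hr l h]

/-- The function `h ↦ Φ(r j(r̄)⁻¹)(h)`, which compares `r` with the representative `j(r̄)` of its
class. -/
def defect (r : Γ) (h : H) : k := D.ext (r * (s.j r)⁻¹) h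

theorem defect_section (a : Γ ⧸ D.N) (h : H) : D.defect s (s.j a) h = 1 := by
  simp [defect, s.mk_j, D.ext_one]

/-- The projection `Γ → Γ/N`, as a morphism from the trivial structure constants. -/
def quotientCocycleHom : (smashDatum k act).Hom (D.cocycle s) where
  toHom := QuotientGroup.mk' D.N
  scale := D.defect s
  map_act _ _ := rfl
  scale_one h := by simpa [s.j_one] using D.defect_section s 1 h
  scale_counit r := by simp [defect, D.ext_at_one]
  scale_σ r t h := by
    simp only [defect, cocycle_σ, QuotientGroup.mk'_apply, ext_section_mul, Units.val_mul]
    exact one_mul _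
  scale_τ l r h := by
    simp only [defect, cocycle_τ, QuotientGroup.mk'_apply, ← Units.val_mul, ext_section_act]
    exact one_mul _

variable (k) in
/-- The quotient datum with the trivial morphism `Φ`. -/
def untwisted (act : H →* MulAut Γ) (N : Subgroup Γ) [normal : N.Normal]
    (stable : ∀ h, ∀ r ∈ N, act h r ∈ N) : QuotientDatum k act where
  N := N
  normal := normal
  stable := stable
  Φ := 1
  Φ_mul _ _ _ := (one_mul _).symm
  Φ_conj _ _ := rfl

theorem cocycle_untwisted (N : Subgroup Γ) [N.Normal] (stable : ∀ h, ∀ r ∈ N, act h r ∈ N)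
    (s : NormalizedSection N) :
    (untwisted k act N stable).cocycle s = smashDatum k (quotientAct act N stable) := rfl

section Scalars

variable {R : Type*} [Ring R] [Algebra k R] {π : Γ →* R} {y : H}
  (hπ : ∀ r : D.N, π r = algebraMap k R (D.Φ r y))

include hπ

theorem ext_smul_map {r : Γ} (hr : r ∈ D.N) (t : Γ) : (D.ext r y : k) • π t = π (r * t) := by
  rw [Algebra.smul_def, ← D.Φ_eq r hr, ← hπ ⟨r, hr⟩, map_mul]

theorem τ_smul_map_section (l : H) (a : Γ ⧸ D.N) :
    (D.cocycle s).τ l a y • π (s.j (quotientAct act D.N D.stable l a)) = π (act l (s.j a)) := by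
  rw [cocycle_τ, D.ext_smul_map hπ (D.mem_τ s l a), inv_mul_cancel_right]

end Scalars

variable [Fintype H] [DecidableEq H]

/-- The projection `k[Γ] ⋊ k^H → k[Γ/N] ⋊_Φ k^H`. -/
def quotientHom : SmashCoproduct k act →ₐc[k] TwistedSmash (D.cocycle s) :=
  map (D.quotientCocycleHom s)

theorem quotientHom_elt (r : Γ) (h : H) :
    D.quotientHom s (elt _ r h) = D.defect s r h • elt _ (r : Γ ⧸ D.N) h :=
  map_elt (D.quotientCocycleHom s) r h

theorem quotientHom_elt_section (a : Γ ⧸ D.N) (h : H) :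
    D.quotientHom s (elt _ (s.j a) h) = elt _ a h := by
  rw [quotientHom_elt, defect_section, one_smul, s.mk_j]

theorem quotientHom_surjective : Function.Surjective (D.quotientHom s) := by
  have h : (D.quotientHom s : _ →ₗ[k] _) ∘ₗ lift (D.cocycle s) (fun a h => elt _ (s.j a) h)
      = LinearMap.id :=
    lin_ext fun a h => by
      rw [LinearMap.comp_apply, lift_elt]
      exact D.quotientHom_elt_section s a h
  exact fun x => ⟨_, LinearMap.congr_fun h x⟩

theorem quotientHom_injective (hN : D.N = ⊥) : Function.Injective (D.quotientHom s) := by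
  have hj (r : Γ) : s.j r = r :=
    (mul_inv_eq_one.1 (Subgroup.mem_bot.1 (hN.le (D.mul_section_inv_mem s r)))).symm
  let f : Γ ⧸ D.N → H → SmashCoproduct k act := fun a h => elt _ (s.j a) h
  have h : lift (D.cocycle s) f ∘ₗ (D.quotientHom s : _ →ₗ[k] _) = LinearMap.id :=
    lin_ext fun r h => by
      have e := D.quotientHom_elt_section s r h
      rw [hj] at e
      calc _ = lift (D.cocycle s) f (elt _ r h) := congrArg (lift (D.cocycle s) f) e
        _ = elt _ (s.j r) h := lift_elt _ f _ _
        _ = elt _ r h := by rw [hj]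
  exact Function.LeftInverse.injective (g := lift (D.cocycle s) f) (LinearMap.congr_fun h)

section Representation

variable {R : Type*} [Ring R] [Algebra k R] {π : Γ →* R} {y : H}
  (hπ : ∀ r : D.N, π r = algebraMap k R (D.Φ r y))

include hπ

/-- The representation of `k[Γ/N] ⋊_Φ k^H` attached to a representation `π` of `Γ` and a point `y`
of `H` such that `N` acts through the scalars `Φ(r)(y)`. -/
def quotientRep : TwistedSmash (D.cocycle s) →ₐ[k] R :=
  projectiveRep _ (fun a => π (s.j a)) y (by rw [s.j_one, map_one]) fun a b => by
    rw [cocycle_σ, D.ext_smul_map hπ (D.mem_σ s a b), inv_mul_cancel_right, map_mul]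

theorem quotientRep_elt (a : Γ ⧸ D.N) (h : H) :
    D.quotientRep s hπ (elt _ a h) = if h = y then π (s.j a) else 0 := by
  rw [quotientRep, projectiveRep_elt]

theorem isHopfFactorization_quotientRep :
    IsHopfFactorization (smashRep π y) (D.quotientHom s) (D.quotientRep s hπ) := by
  have h : (D.quotientRep s hπ).toLinearMap ∘ₗ (D.quotientHom s).toCoalgHom.toLinearMap
      = (smashRep (k := k) (act := act) π y).toLinearMap := by
    refine lin_ext fun r h => ?_
    change D.quotientRep s hπ (D.quotientHom s (elt _ r h)) = smashRep π y (elt _ r h)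
    rw [quotientHom_elt, map_smul, quotientRep_elt, smashRep_elt]
    split_ifs with hy
    · rw [hy, defect, D.ext_smul_map hπ (D.mul_section_inv_mem s r), inv_mul_cancel_right]
    · rw [smul_zero]
  exact ⟨D.quotientHom_surjective s, LinearMap.congr_fun h⟩

theorem coeff_quotientRep (f : R →ₗ[k] k) : toConv (f ∘ₗ (D.quotientRep s hπ).toLinearMap)
    = pointFun (D.cocycle s) (fun a => f (π (s.j a))) y := by
  refine ofConv_injective (lin_ext fun a h => ?_)
  change f (D.quotientRep s hπ (elt _ a h)) = pointFun _ _ y (elt _ a h)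
  rw [quotientRep_elt, pointFun_elt]
  split_ifs <;> simp

theorem pointFun_coeff_mem (f : R →ₗ[k] k) :
    pointFun (D.cocycle s) (fun a => f (π (s.j a))) y
      ∈ coeffAlgebra (D.quotientRep s hπ).toLinearMap := by
  rw [← D.coeff_quotientRep s hπ]
  exact coeff_mem_coeffAlgebra _ f

theorem pointFun_coeff_mul_coeff_mem (f g : R →ₗ[k] k) :
    pointFun (D.cocycle s) (fun a => f (π (s.j a)) * g (π (act y⁻¹ (s.j a)))) (y * y)
      ∈ coeffAlgebra (D.quotientRep s hπ).toLinearMap := by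
  convert mul_mem (D.pointFun_coeff_mem s hπ f) (D.pointFun_coeff_mem s hπ g) using 1
  rw [pointFun_mul_pointFun]
  congr 1
  funext a
  rw [← D.τ_smul_map_section s hπ, map_smul, smul_eq_mul, mul_left_comm]

end Representation

end QuotientDatum

section DihedralGamma

theorem gamma_induction {P : Gamma 2 2 → Prop} (one : P 1) (gen_mul : ∀ i r, P r → P (gen i * r))
    (r : Gamma 2 2) : P r := by
  have hr : r ∈ Subgroup.closure (Set.range (gen : ZMod 2 → Gamma 2 2)) :=
    PresentedGroup.closure_range_of (gammaRels 2 2) ▸ Subgroup.mem_top r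
  induction hr using Subgroup.closure_induction_left with
  | one => exact one
  | mul_left _ hg r _ ih =>
    obtain ⟨i, rfl⟩ := hg
    exact gen_mul i r ih
  | inv_mul_cancel _ hg r _ ih =>
    obtain ⟨i, rfl⟩ := hg
    exact gen_inv i ▸ gen_mul i r ih

theorem gen_zero_mul_rot_zpow (n : ℤ) : gen 0 * rot ^ n = rot ^ (-n) * gen 0 := by
  have h : gen 0 * rot * (gen 0)⁻¹ = rot⁻¹ := by
    rw [rot_inv, gen_inv, rot, ← mul_assoc, gen_mul_self, one_mul]
  rw [zpow_neg, ← inv_zpow, ← h, conj_zpow, inv_mul_cancel_right]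

theorem gen_one_eq_rot_inv_mul : gen 1 = rot⁻¹ * gen 0 := by
  rw [rot_inv, mul_assoc, gen_mul_self, mul_one]

theorem exists_eq_rot_zpow_or (r : Gamma 2 2) : ∃ n : ℤ, r = rot ^ n ∨ r = rot ^ n * gen 0 := by
  have zero_mul (r : Gamma 2 2) : (∃ n : ℤ, r = rot ^ n ∨ r = rot ^ n * gen 0) →
      ∃ n : ℤ, gen 0 * r = rot ^ n ∨ gen 0 * r = rot ^ n * gen 0 := by
    rintro ⟨n, rfl | rfl⟩
    · exact ⟨-n, .inr (gen_zero_mul_rot_zpow n)⟩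
    · refine ⟨-n, .inl ?_⟩
      rw [← mul_assoc, gen_zero_mul_rot_zpow, mul_assoc, gen_mul_self, mul_one]
  induction r using gamma_induction with
  | one => exact ⟨0, .inl (zpow_zero _).symm⟩
  | gen_mul i r ih =>
    obtain ⟨n, hn⟩ := zero_mul r ih
    obtain rfl | rfl : i = 0 ∨ i = 1 := by revert i; decide
    · exact ⟨n, hn⟩
    · refine ⟨n - 1, ?_⟩
      rw [gen_one_eq_rot_inv_mul, mul_assoc, sub_eq_neg_add, zpow_add, zpow_neg_one,
        mul_assoc, mul_right_inj, mul_right_inj]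
      exact hn

/-- The projection of `Γ_{2,2}` onto the dihedral group of order `2 m` (infinite for `m = 0`). -/
def gammaToDihedralMod (m : ℕ) : Gamma 2 2 →* DihedralGroup m :=
  PresentedGroup.toGroup (f := fun i : ZMod 2 => DihedralGroup.sr (i.val : ZMod m)) (by
    rintro _ (⟨i, rfl⟩ | ⟨x, rfl⟩)
    · simp [sq]
    · simp [map_commutatorElement, commutatorElement_eq_one_iff_mul_comm, List.ofFn_succ, add_comm])

theorem gammaToDihedralMod_gen (m : ℕ) (i : ZMod 2) :
    gammaToDihedralMod m (gen i) = DihedralGroup.sr (i.val : ZMod m) :=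
  PresentedGroup.toGroup.of _

theorem gammaToDihedralMod_rot_zpow (m : ℕ) (n : ℤ) :
    gammaToDihedralMod m (rot ^ n) = DihedralGroup.r (n : ZMod m) := by
  rw [map_zpow, rot, map_mul, gammaToDihedralMod_gen, gammaToDihedralMod_gen,
    DihedralGroup.sr_mul_sr]
  simp [ZMod.val_one]

theorem gammaToDihedralMod_rot_zpow_mul_gen_zero (m : ℕ) (n : ℤ) :
    gammaToDihedralMod m (rot ^ n * gen 0) = DihedralGroup.sr (-n : ZMod m) := by
  rw [map_mul, gammaToDihedralMod_rot_zpow, gammaToDihedralMod_gen]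
  simp

theorem gammaToDihedralMod_surjective (m : ℕ) : Function.Surjective (gammaToDihedralMod m) := by
  rintro (i | i) <;> obtain ⟨n, rfl⟩ := ZMod.intCast_surjective i
  · exact ⟨rot ^ n, gammaToDihedralMod_rot_zpow m n⟩
  · exact ⟨rot ^ (-n) * gen 0, by
      rw [gammaToDihedralMod_rot_zpow_mul_gen_zero, Int.cast_neg, neg_neg]⟩

theorem rot_zpow_mem_rotSubgroup {m : ℕ} {n : ℤ} (h : (m : ℤ) ∣ n) : rot ^ n ∈ rotSubgroup m := by
  obtain ⟨c, rfl⟩ := h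
  exact ⟨c, by simp [zpow_mul]⟩

theorem ker_gammaToDihedralMod (m : ℕ) : (gammaToDihedralMod m).ker = rotSubgroup m := by
  refine le_antisymm (fun r hr => ?_) (Subgroup.zpowers_le.2 ?_)
  · rw [MonoidHom.mem_ker, DihedralGroup.one_def] at hr
    obtain ⟨n, rfl | rfl⟩ := exists_eq_rot_zpow_or r
    · rw [gammaToDihedralMod_rot_zpow, DihedralGroup.r.injEq] at hr
      exact rot_zpow_mem_rotSubgroup ((ZMod.intCast_zmod_eq_zero_iff_dvd _ _).1 hr)
    · cases (gammaToDihedralMod_rot_zpow_mul_gen_zero m n).symm.trans hr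
  · rw [MonoidHom.mem_ker, ← zpow_natCast, gammaToDihedralMod_rot_zpow, DihedralGroup.one_def]
    simp

theorem index_rotSubgroup (m : ℕ) : (rotSubgroup m).index = 2 * m := by
  rw [← ker_gammaToDihedralMod, Subgroup.index_ker,
    MonoidHom.range_eq_top.2 (gammaToDihedralMod_surjective m), Subgroup.card_top,
    DihedralGroup.nat_card]

end DihedralGamma

section GammaMatrix

variable {k : Type*} [Field k] (q : kˣ)

theorem theta_paramQ (i c : ZMod 2) : theta (paramQ q) i c = if i = c then q⁻¹ else q := by
  obtain rfl | rfl : i = 0 ∨ i = 1 := by revert i; decide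
  all_goals
    obtain rfl | rfl : c = 0 ∨ c = 1 := by revert c; decide
    all_goals simp [theta, paramQ]

theorem theta_add_one (i c : ZMod 2) :
    theta (paramQ q) (i + 1) (c + 1) = theta (paramQ q) i c := by
  simp only [theta_paramQ, add_left_inj]

/-- The representation of `Γ_{2,2}` underlying `rho q`. -/
def gammaMatrix : Gamma 2 2 →* Matrix (ZMod 2) (ZMod 2) k := (Units.coeHom _).comp (gammaRep q)

theorem gammaMatrix_gen (i : ZMod 2) : gammaMatrix q (gen i) = genMatrix q i :=
  congrArg Units.val (PresentedGroup.toGroup.of _ : gammaRep q (gen i) = genUnit q i)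

theorem gammaMatrix_rot_zpow (n : ℤ) : gammaMatrix q (rot ^ n)
    = Matrix.diagonal fun c => ((theta (paramQ q) 1 c ^ (2 * n) : kˣ) : k) := by
  let diagonal : (ZMod 2 → kˣ) →* (Matrix (ZMod 2) (ZMod 2) k)ˣ :=
    (Units.map (Matrix.diagonalRingHom (ZMod 2) k).toMonoidHom).comp
      MulEquiv.piUnits.symm.toMonoidHom
  have hrot : gammaRep q rot = diagonal (theta (paramQ q) 1 ^ 2) := Units.ext <| by
    change gammaMatrix q rot = Matrix.diagonal fun c => ((theta (paramQ q) 1 c ^ 2 : kˣ) : k)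
    rw [rot, map_mul, gammaMatrix_gen, gammaMatrix_gen, genMatrix_mul]
    congr 1
    funext c
    have h : theta (paramQ q) 0 (c - 1) = theta (paramQ q) 1 c := by
      simpa using (theta_add_one q 0 (c - 1)).symm
    rw [h, sq, Units.val_mul]
  change ((gammaRep q (rot ^ n) : (Matrix (ZMod 2) (ZMod 2) k)ˣ) : Matrix (ZMod 2) (ZMod 2) k) = _
  rw [map_zpow, hrot, ← map_zpow, ← zpow_natCast, ← zpow_mul]
  rfl

theorem gammaMatrix_rot_zpow_zero_apply (n : ℤ) (c : ZMod 2) :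
    gammaMatrix q (rot ^ n) 0 c = if c = 0 then ((q ^ (2 * n) : kˣ) : k) else 0 := by
  rw [gammaMatrix_rot_zpow, Matrix.diagonal_apply, theta_paramQ]
  simp only [eq_comm, zero_ne_one, if_false]

theorem gammaMatrix_rot_zpow_mul_gen_zero_apply (n : ℤ) (c : ZMod 2) :
    gammaMatrix q (rot ^ n * gen 0) 0 c
      = if c = 1 then ((q ^ (2 * n + 1) : kˣ) : k) else 0 := by
  rw [map_mul, gammaMatrix_rot_zpow, gammaMatrix_gen, Matrix.diagonal_mul, genMatrix,
    Matrix.of_apply, theta_paramQ, theta_paramQ, zpow_add_one, Units.val_mul]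
  obtain rfl | rfl : c = 0 ∨ c = 1 := by revert c; decide
  · simp
  · simp

theorem exists_gammaMatrix_zero_apply_ne_zero (r : Gamma 2 2) : ∃ c, gammaMatrix q r 0 c ≠ 0 := by
  by_contra! h
  have h1 : (gammaMatrix q r * gammaMatrix q r⁻¹) 0 0 = 0 := by
    simp only [Matrix.mul_apply, h, zero_mul, Finset.sum_const_zero]
  rw [← map_mul, mul_inv_cancel, map_one] at h1
  exact one_ne_zero h1

theorem gammaMatrix_act (r : Gamma 2 2) :
    gammaMatrix q (cyclicAct 2 2 (Multiplicative.ofAdd 1) r)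
      = (gammaMatrix q r).submatrix (Equiv.addRight 1) (Equiv.addRight 1) := by
  induction r using gamma_induction with
  | one => rw [map_one, map_one, Matrix.submatrix_one_equiv]
  | gen_mul i r ih =>
    have hgen : genMatrix q (i + 1)
        = (genMatrix q i).submatrix (Equiv.addRight 1) (Equiv.addRight 1) := by
      ext d c
      have hc : c + 1 + 1 = c := by rw [add_assoc, CharTwo.add_self_eq_zero, add_zero]
      have hθ := theta_add_one q i (c + 1)
      rw [hc] at hθ
      simp only [genMatrix, Matrix.submatrix_apply, Matrix.of_apply, Equiv.coe_addRight, hθ,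
        eq_sub_iff_add_eq, add_left_inj]
    rw [map_mul, map_mul, map_mul, cyclicAct_gen, gammaMatrix_gen, gammaMatrix_gen, ih, toAdd_ofAdd,
      hgen, Matrix.submatrix_mul_equiv]

theorem gammaMatrix_act_one_add_one_apply (r : Gamma 2 2) (c : ZMod 2) :
    gammaMatrix q (cyclicAct 2 2 (Multiplicative.ofAdd 1) r) 1 (c + 1) = gammaMatrix q r 0 c := by
  rw [gammaMatrix_act]
  change gammaMatrix q r (1 + 1) (c + 1 + 1) = _
  rw [add_assoc, CharTwo.add_self_eq_zero, add_zero]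

theorem inv_mul_mem_rotSubgroup {r t : Gamma 2 2}
    (h : ∀ c, gammaMatrix q r 0 c ^ 2 = gammaMatrix q t 0 c ^ 2) :
    r⁻¹ * t ∈ rotSubgroup (orderOf (q ^ 4)) := by
  have mk_rot_zpow (n l e : ℤ)
      (hq : ((q ^ (2 * n + e) : kˣ) : k) ^ 2 = ((q ^ (2 * l + e) : kˣ) : k) ^ 2) :
      (rot ^ n : Gamma 2 2 ⧸ rotSubgroup (orderOf (q ^ 4))) = rot ^ l := by
    have sq_zpow (j : ℤ) : (q ^ (2 * j + e)) ^ 2 = (q ^ 4) ^ j * q ^ (2 * e) := by group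
    norm_cast at hq
    rw [sq_zpow, sq_zpow, mul_left_inj, zpow_eq_zpow_iff_modEq] at hq
    rw [← QuotientGroup.mk_zpow, ← QuotientGroup.mk_zpow, QuotientGroup.eq, ← zpow_neg,
      ← zpow_add, neg_add_eq_sub]
    exact rot_zpow_mem_rotSubgroup hq.dvd
  have h0 := h 0
  have h1 := h 1
  rw [← QuotientGroup.eq]
  obtain ⟨n, rfl | rfl⟩ := exists_eq_rot_zpow_or r <;>
    obtain ⟨l, rfl | rfl⟩ := exists_eq_rot_zpow_or t <;>
    simp only [gammaMatrix_rot_zpow_zero_apply, gammaMatrix_rot_zpow_mul_gen_zero_apply] at h0 h1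
  · exact mk_rot_zpow n l 0 (by simpa using h0)
  · simp [zpow_ne_zero _ q.ne_zero] at h0
  · simp [zpow_ne_zero _ q.ne_zero] at h1
  · rw [QuotientGroup.mk_mul, QuotientGroup.mk_mul]
    exact congrArg (· * _) (mk_rot_zpow n l 1 (by simpa using h1))

theorem gammaMatrix_rot_pow_zpow {m : ℕ} (h : (q ^ 4) ^ m = 1) (n : ℤ) :
    gammaMatrix q ((rot ^ m) ^ n) = algebraMap k _ (((q ^ (2 * m)) ^ n : kˣ) : k) := by
  have hθ (c : ZMod 2) : theta (paramQ q) 1 c ^ (2 * m) = q ^ (2 * m) := by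
    rw [theta_paramQ]
    split_ifs
    · rw [inv_pow, inv_eq_iff_mul_eq_one, ← h]
      group
    · rfl
  rw [← zpow_natCast, ← zpow_mul, gammaMatrix_rot_zpow, Matrix.algebraMap_eq_diagonal]
  congr 1
  funext c
  rw [← mul_assoc, zpow_mul, ← hθ c]
  norm_cast

end GammaMatrix

section HopfImageOfRho

open TwistedSmash

variable {k : Type u} [Field k] {q : kˣ} {D : QuotientDatum k (cyclicAct 2 2)}

/-- The quotient data `(N, Φ)` which describe the Hopf image of `rho q`: `N` is `N_m` for `m` the
order of `q ^ 4`, and `N` acts on `k^2` through the scalars `Φ(r)(h)`. -/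
structure QuotientDatum.IsImageDatum (D : QuotientDatum k (cyclicAct 2 2)) (q : kˣ) : Prop where
  N_eq : D.N = rotSubgroup (orderOf (q ^ 4))
  map_eq : ∀ r : D.N, gammaMatrix q r = algebraMap k _ (D.Φ r (Multiplicative.ofAdd 1) : k)

namespace QuotientDatum.IsImageDatum

theorem pointFun_sq_mem (hD : D.IsImageDatum q) (s : NormalizedSection D.N) (c : ZMod 2) :
    pointFun (D.cocycle s) (fun a => gammaMatrix q (s.j a) 0 c ^ 2) 1
      ∈ coeffAlgebra (D.quotientRep s hD.map_eq).toLinearMap := by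
  convert D.pointFun_coeff_mul_coeff_mem s hD.map_eq (Matrix.entryLinearMap k k 0 c)
    (Matrix.entryLinearMap k k 1 (c + 1)) using 2
  · funext a
    have hact : gammaMatrix q (cyclicAct 2 2 (Multiplicative.ofAdd 1)⁻¹ (s.j a)) 1 (c + 1)
        = gammaMatrix q (s.j a) 0 c := gammaMatrix_act_one_add_one_apply q (s.j a) c
    rw [Matrix.entryLinearMap_apply, Matrix.entryLinearMap_apply, hact, sq]
  · rfl

theorem coeffsSeparate (hD : D.IsImageDatum q) (s : NormalizedSection D.N) :
    CoeffsSeparate (D.quotientRep s hD.map_eq).toLinearMap := by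
  refine fun x => eq_zero_of_forall_mem_subalgebra _ _ (fun a b hba => ?_) fun a h => ?_
  · by_contra! hab
    refine hba ?_
    rw [← s.mk_j a, ← s.mk_j b, eq_comm, QuotientGroup.eq]
    exact hD.N_eq.ge (inv_mul_mem_rotSubgroup q fun c => hab _ (hD.pointFun_sq_mem s c))
  · obtain rfl | rfl : h = 1 ∨ h = Multiplicative.ofAdd 1 := by revert h; decide
    · refine ⟨1, ?_, one_ne_zero⟩
      rw [pointFun_one_one]
      exact one_mem _
    · obtain ⟨c, hc⟩ := exists_gammaMatrix_zero_apply_ne_zero q (s.j a)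
      exact ⟨_, D.pointFun_coeff_mem s hD.map_eq (Matrix.entryLinearMap k k 0 c), hc⟩

theorem isHopfImage (hD : D.IsImageDatum q) (s : NormalizedSection D.N) :
    IsHopfImage (rho q) (D.quotientHom s) (D.quotientRep s hD.map_eq) :=
  (D.isHopfFactorization_quotientRep s hD.map_eq).isHopfImage (hD.coeffsSeparate s)

section Uniqueness

variable {A : Type v} [Ring A] [HopfAlgebra k A] {p : SmashCoproduct k (cyclicAct 2 2) →ₐc[k] A}
  {φ : A →ₐ[k] Matrix (ZMod 2) (ZMod 2) k}

theorem nonempty_bialgEquiv (hD : D.IsImageDatum q) (h : IsHopfImage (rho q) p φ)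
    (s : NormalizedSection D.N) : Nonempty (A ≃ₐc[k] TwistedSmash (D.cocycle s)) :=
  (D.isHopfFactorization_quotientRep s hD.map_eq).nonempty_bialgEquiv (hD.coeffsSeparate s) h

theorem nonempty_bialgEquiv_smashCoproduct (hD : D.IsImageDatum q) (h : IsHopfImage (rho q) p φ)
    (hq : orderOf (q ^ 4) = 0) : Nonempty (A ≃ₐc[k] SmashCoproduct k (cyclicAct 2 2)) := by
  have hN : D.N = ⊥ := by rw [hD.N_eq, hq, rotSubgroup, pow_zero, Subgroup.zpowers_one_eq_bot]
  obtain ⟨s⟩ := NormalizedSection.nonempty D.N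
  obtain ⟨e⟩ := hD.nonempty_bialgEquiv h s
  exact ⟨e.trans (BialgEquiv.ofBijective (D.quotientHom s)
    ⟨D.quotientHom_injective s hN, D.quotientHom_surjective s⟩).symm⟩

theorem card_quotient (hD : D.IsImageDatum q) :
    Nat.card (Gamma 2 2 ⧸ D.N) = 2 * orderOf (q ^ 4) := by
  rw [← index_rotSubgroup, ← hD.N_eq, Subgroup.index]

theorem finite_iff_isOfFinOrder (hD : D.IsImageDatum q) (h : IsHopfImage (rho q) p φ) :
    Module.Finite k A ↔ IsOfFinOrder (q ^ 4) := by
  obtain ⟨s⟩ := NormalizedSection.nonempty D.N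
  obtain ⟨e⟩ := hD.nonempty_bialgEquiv h s
  let e' : A ≃ₐ[k] TwistedSmash (D.cocycle s) := e
  rw [Module.Finite.equiv_iff e'.toLinearEquiv, TwistedSmash.finite_iff, ← orderOf_pos_iff]
  refine ⟨fun _ => ?_, fun hq => Nat.finite_of_card_ne_zero ?_⟩
  · have := hD.card_quotient ▸ Nat.card_pos (α := Gamma 2 2 ⧸ D.N)
    lia
  · rw [hD.card_quotient]
    lia

theorem finrank_eq (hD : D.IsImageDatum q) (h : IsHopfImage (rho q) p φ) :
    Module.finrank k A = 4 * orderOf (q ^ 4) := by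
  obtain ⟨s⟩ := NormalizedSection.nonempty D.N
  obtain ⟨e⟩ := hD.nonempty_bialgEquiv h s
  have card_two : Nat.card (Multiplicative (ZMod 2)) = 2 := Nat.card_zmod 2
  let e' : A ≃ₐ[k] TwistedSmash (D.cocycle s) := e
  rw [e'.toLinearEquiv.finrank_eq, TwistedSmash.finrank_eq, hD.card_quotient, card_two]
  ring

end Uniqueness

end QuotientDatum.IsImageDatum

theorem isImageDatum_untwisted {m : ℕ} (hm : m = orderOf (q ^ 4)) (hq : q ^ (2 * m) = 1) :
    (QuotientDatum.untwisted k (cyclicAct 2 2) (rotSubgroup m)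
      (rotSubgroup_stable m)).IsImageDatum q where
  N_eq := congrArg rotSubgroup hm
  map_eq := by
    rintro ⟨_, n, rfl⟩
    rw [gammaMatrix_rot_pow_zpow q (hm ▸ pow_orderOf_eq_one _), hq, one_zpow]
    rfl

theorem isImageDatum_rotDatum {m : ℕ} (hm₀ : 0 < m) (hm : m = orderOf (q ^ 4))
    (hq : q ^ (2 * m) = -1) : (rotDatum k hm₀).IsImageDatum q where
  N_eq := congrArg rotSubgroup hm
  map_eq := by
    rintro ⟨_, n, rfl⟩
    have hchi : chi k (Multiplicative.ofAdd 1) = -1 := if_neg (by decide)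
    have hΦ : (rotDatum k hm₀).Φ ⟨(rot ^ m) ^ n, n, rfl⟩ = chi k ^ n := rotPhi_zpow k hm₀ n _
    exact (gammaMatrix_rot_pow_zpow q (hm ▸ pow_orderOf_eq_one _) n).trans
      (by rw [hΦ, Pi.pow_apply, hchi, hq])

theorem pow_two_mul_orderOf_pow_four (q : kˣ) :
    q ^ (2 * orderOf (q ^ 4)) = 1 ∨ q ^ (2 * orderOf (q ^ 4)) = -1 := by
  rw [← Units.inv_eq_self_iff, inv_eq_iff_mul_eq_one, ← pow_add, ← add_mul, pow_mul]
  exact pow_orderOf_eq_one _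

theorem exists_isImageDatum (q : kˣ) :
    ∃ D : QuotientDatum k (cyclicAct 2 2), D.IsImageDatum q := by
  by_cases h : q ^ (2 * orderOf (q ^ 4)) = 1
  · exact ⟨_, isImageDatum_untwisted rfl h⟩
  · have hm : 0 < orderOf (q ^ 4) :=
      Nat.pos_of_ne_zero fun h0 => h (by rw [h0, mul_zero, pow_zero])
    exact ⟨_, isImageDatum_rotDatum hm rfl ((pow_two_mul_orderOf_pow_four q).resolve_left h)⟩

end HopfImageOfRho

section Order

variable {G : Type*} [Monoid G] {x : G}

theorem orderOf_pow_four_of_odd (hx : Odd (orderOf x)) : orderOf (x ^ 4) = orderOf x :=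
  (hx.coprime_two_right.pow_right 2).orderOf_pow

theorem orderOf_pow_four_of_mod_four_eq_two (hx : orderOf x % 4 = 2) :
    orderOf (x ^ 4) = orderOf x / 2 := by
  rw [orderOf_pow' x (by norm_num), Nat.gcd_comm, Nat.gcd_rec, hx]
  rfl

theorem orderOf_pow_four_of_eq_four_mul {n : ℕ} (hx : orderOf x = 4 * n) :
    orderOf (x ^ 4) = n := by
  rw [orderOf_pow' x (by norm_num), hx, Nat.gcd_eq_right (dvd_mul_right 4 n),
    Nat.mul_div_cancel_left n (by norm_num)]

theorem pow_two_mul_orderOf_pow_four_eq_neg_one {k : Type*} [Field k] {q : kˣ} {n : ℕ}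
    (hn : 0 < n) (hq : orderOf q = 4 * n) : q ^ (2 * n) = -1 := by
  have h := pow_two_mul_orderOf_pow_four q
  rw [orderOf_pow_four_of_eq_four_mul hq] at h
  exact h.resolve_left (pow_ne_one_of_lt_orderOf (by lia) (by lia))

end Order

end

theorem proposition5p8_general {k : Type u} [Field k] (q : kˣ) :
    (∃ (L : Type u) (_ : Ring L) (_ : HopfAlgebra k L)
      (p : SmashCoproduct k (cyclicAct 2 2) →ₐc[k] L) (φ : L →ₐ[k] Matrix (ZMod 2) (ZMod 2) k),
      IsHopfImage (rho q) p φ) ∧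
    ∀ (A : Type v) [Ring A] [HopfAlgebra k A]
      (p : SmashCoproduct k (cyclicAct 2 2) →ₐc[k] A) (φ : A →ₐ[k] Matrix (ZMod 2) (ZMod 2) k),
      IsHopfImage (rho q) p φ →
        (¬ IsOfFinOrder q → Nonempty (A ≃ₐc[k] SmashCoproduct k (cyclicAct 2 2))) ∧
        (Odd (orderOf q) → Nonempty (A ≃ₐc[k] HopfA k (orderOf q))) ∧
        (orderOf q % 4 = 2 → Nonempty (A ≃ₐc[k] HopfA k (orderOf q / 2))) ∧
        (∀ (n : ℕ) (hn : 0 < n) (s : NormalizedSection (rotSubgroup n)),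
          orderOf q = 4 * n → Nonempty (A ≃ₐc[k] HopfB k hn s)) ∧
        (IsOfFinOrder (q ^ 4) → Module.Finite k A ∧ Module.finrank k A = 4 * orderOf (q ^ 4)) ∧
        (¬ IsOfFinOrder (q ^ 4) → ¬ Module.Finite k A) := by
  obtain ⟨D, hD⟩ := exists_isImageDatum q
  refine ⟨?_, fun A _ _ p φ h => ?_⟩
  · obtain ⟨s⟩ := NormalizedSection.nonempty D.N
    exact ⟨_, _, _, _, _, hD.isHopfImage s⟩
  have equivA {m : ℕ} (hm : m = orderOf (q ^ 4)) (hq : q ^ (2 * m) = 1) :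
      Nonempty (A ≃ₐc[k] HopfA k m) := by
    obtain ⟨s⟩ := NormalizedSection.nonempty (rotSubgroup m)
    have e := (isImageDatum_untwisted hm hq).nonempty_bialgEquiv h s
    rw [QuotientDatum.cocycle_untwisted] at e
    exact e
  refine ⟨fun hq => ?_, fun hq => ?_, fun hq => ?_, fun n hn s hq => ?_, fun hq => ?_, fun hq => ?_⟩
  · refine hD.nonempty_bialgEquiv_smashCoproduct h (orderOf_eq_zero ?_)
    rwa [isOfFinOrder_pow, or_iff_left (by norm_num)]
  · exact equivA (orderOf_pow_four_of_odd hq).symm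
      (by rw [mul_comm, pow_mul, pow_orderOf_eq_one, one_pow])
  · exact equivA (orderOf_pow_four_of_mod_four_eq_two hq).symm
      (by rw [Nat.mul_div_cancel' (by lia), pow_orderOf_eq_one])
  · exact (isImageDatum_rotDatum hn (orderOf_pow_four_of_eq_four_mul hq).symm
      (pow_two_mul_orderOf_pow_four_eq_neg_one hn hq)).nonempty_bialgEquiv h s
  · exact ⟨(hD.finite_iff_isOfFinOrder h).2 hq, hD.finrank_eq h⟩
  · rwa [hD.finite_iff_isOfFinOrder h]

/-- Existence and description of the Hopf image `A_q` of `ρ_q` over a field of characteristic zero;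
`orderOf q` is the order `m` of `q` (and is `0` if `q` has infinite order). -/
theorem proposition5p8 {k : Type u} [Field k] [CharZero k] (q : kˣ) :
    (∃ (L : Type u) (_ : Ring L) (_ : HopfAlgebra k L)
      (p : SmashCoproduct k (cyclicAct 2 2) →ₐc[k] L) (φ : L →ₐ[k] Matrix (ZMod 2) (ZMod 2) k),
      IsHopfImage (rho q) p φ) ∧
    ∀ (A : Type v) [Ring A] [HopfAlgebra k A]
      (p : SmashCoproduct k (cyclicAct 2 2) →ₐc[k] A) (φ : A →ₐ[k] Matrix (ZMod 2) (ZMod 2) k),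
      IsHopfImage (rho q) p φ →
        (¬ IsOfFinOrder q → Nonempty (A ≃ₐc[k] SmashCoproduct k (cyclicAct 2 2))) ∧
        (Odd (orderOf q) → Nonempty (A ≃ₐc[k] HopfA k (orderOf q))) ∧
        (orderOf q % 4 = 2 → Nonempty (A ≃ₐc[k] HopfA k (orderOf q / 2))) ∧
        (∀ (n : ℕ) (hn : 0 < n) (s : NormalizedSection (rotSubgroup n)),
          orderOf q = 4 * n → Nonempty (A ≃ₐc[k] HopfB k hn s)) ∧
        (IsOfFinOrder (q ^ 4) → Module.Finite k A ∧ Module.finrank k A = 4 * orderOf (q ^ 4)) ∧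
        (¬ IsOfFinOrder (q ^ 4) → ¬ Module.Finite k A) :=
  proposition5p8_general q
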